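/- Let $G=(A\cup B,E)$ be a finite bipartite graph in which every vertex $v$ has a strict preference ordering over its neighbours, a lower quota $q^-(v)\in\mathbb{Z}_{\ge 0}$ and an upper quota $q^+(v)\in\mathbb{Z}_{\ge 1}$ with $q^-(v)\le q^+(v)$. A matching is a set $M\subseteq E$ such that the set $M(v)$ of partners of $v$ satisfies $|M(v)|\le q^+(v)$ for every vertex $v$. Its deficiency is $\sum_{v\in A\cup B}\max\{0,q^-(v)-|M(v)|\}$, and $M$ is critical if no matching has smaller deficiency. To compare matchings $M$ and $N$, regard $M(v)$ and $N(v)$ as multisets of size exactly $q^+(v)$ by adding copies of a symbol $\bot$, to which $v$ prefers every neighbour. A correspondence function $\mathrm{corr}$ from $M$ to $N$ consists of a bijection $\mathrm{corr}_v$ from the multiset difference $M(v)\setminus N(v)$ to the multiset difference $N(v)\setminus M(v)$ for every vertex $v$. Let $\Delta(M,N,\mathrm{corr})=\sum_{v}\sum_{u\in M(v)\setminus N(v)}\mathrm{vote}_v(u,\mathrm{corr}_v(u))$, where $\mathrm{vote}_v(u,u')$ is $1$ if $v$ prefers $u$ to $u'$, $-1$ if $v$ prefers $u'$ to $u$, and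 $0$ otherwise. A popular critical matching is a critical matching $M$ such that $\Delta(N,M,\mathrm{corr})\le 0$ for every critical matching $N$ and every correspondence function $\mathrm{corr}$ from $N$ to $M$. Theorem. There is an algorithm (one program for a unit-cost random access machine with comparison, addition and subtraction, whose input consists of the quotas and of the preference lists of all vertices) that on every such instance outputs a popular critical matching $M$ with $|N|\le|M|$ for every popular critical matching $N$. Its running time is $O(|E|(|A|+|B|+|E|))$ when $E\neq\emptyset$, and $O(\max\{1,|A|+|B|\})$ when $E=\emptyset$. In particular, every instance has a popular critical matching. -/

import Mathlib

namespace ManyToMany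

/-! ### Instances, matchings, criticality -/

/-- A many-to-many instance on the bipartite graph with sides `A` and `B`.  `prefA a` lists the
neighbours of `a` without repetition, the most preferred one first; `prefB b` likewise.  So the
lists carry both the edge set and the strict preference orderings. -/
structure QuotaInstance (A B : Type*) where
  prefA : A → List B
  prefB : B → List A
  prefA_nodup : ∀ a, (prefA a).Nodup
  prefB_nodup : ∀ b, (prefB b).Nodup
  mem_prefA_iff : ∀ a b, b ∈ prefA a ↔ a ∈ prefB b
  lowA : A → ℕ
  upA : A → ℕ
  lowB : B → ℕ
  upB : B → ℕ
  lowA_le_upA : ∀ a, lowA a ≤ upA a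
  lowB_le_upB : ∀ b, lowB b ≤ upB b
  upA_pos : ∀ a, 1 ≤ upA a
  upB_pos : ∀ b, 1 ≤ upB b

section Matchings

variable {A B : Type*} [Fintype A] [Fintype B] [DecidableEq A] [DecidableEq B]

/-- The set of partners of `a` in `M`. -/
def partnersA (M : Finset (A × B)) (a : A) : Finset B :=
  Finset.univ.filter fun b => (a, b) ∈ M

/-- The set of partners of `b` in `M`. -/
def partnersB (M : Finset (A × B)) (b : B) : Finset A :=
  Finset.univ.filter fun a => (a, b) ∈ M

/-- The edge set. -/
def QuotaInstance.edges (I : QuotaInstance A B) : Finset (A × B) :=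
  Finset.univ.filter fun e => e.2 ∈ I.prefA e.1

/-- A matching is a set of edges that respects the upper quotas. -/
def QuotaInstance.IsMatching (I : QuotaInstance A B) (M : Finset (A × B)) : Prop :=
  M ⊆ I.edges ∧ (∀ a, (partnersA M a).card ≤ I.upA a) ∧ (∀ b, (partnersB M b).card ≤ I.upB b)

/-- Total deficiency; the subtraction of natural numbers is truncated,
so `q - k` is `max 0 (q - k)`. -/
def QuotaInstance.deficiency (I : QuotaInstance A B) (M : Finset (A × B)) : ℕ :=
  ∑ a, (I.lowA a - (partnersA M a).card) + ∑ b, (I.lowB b - (partnersB M b).card)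

/-- A matching of minimum deficiency among all matchings. -/
def QuotaInstance.IsCritical (I : QuotaInstance A B) (M : Finset (A × B)) : Prop :=
  I.IsMatching M ∧ ∀ N, I.IsMatching N → I.deficiency M ≤ I.deficiency N

end Matchings

/-! ### Votes and popularity.  `none` plays the role of an unfilled position. -/

section Popularity

/-- The vote of a vertex with preference list `l` for `x` against `y`: any neighbour is
preferred to an unfilled position. -/
def vote {X : Type*} [DecidableEq X] (l : List X) : Option X → Option X → ℤ
  | some x, some y => if l.idxOf x < l.idxOf y then 1 else if l.idxOf y < l.idxOf x then -1 else 0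
  | some _, none => 1
  | none, some _ => -1
  | none, none => 0

/-- The `q` positions of a vertex with upper quota `q` and partner set `S`:
the partners, and an unfilled position for the rest of the quota. -/
def positions {X : Type*} (q : ℕ) (S : Finset X) : Multiset (Option X) :=
  S.val.map some + Multiset.replicate (q - S.card) none

/-- `K` is (the graph of) a bijection from the positions of `S` that are not in `T` to the
positions of `T` that are not in `S`, as multisets: the common positions, filled or not,
are cancelled. -/
def IsPairing {X : Type*} [DecidableEq X] (q : ℕ) (S T : Finset X)
    (K : Multiset (Option X × Option X)) : Prop :=
  K.map Prod.fst = positions q S - positions q T ∧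
    K.map Prod.snd = positions q T - positions q S

variable {A B : Type*} [Fintype A] [Fintype B] [DecidableEq A] [DecidableEq B]

/-- A correspondence function from `M` to `N`: every vertex fixes a bijection. -/
structure Correspondence (I : QuotaInstance A B) (M N : Finset (A × B)) where
  corrA : A → Multiset (Option B × Option B)
  corrB : B → Multiset (Option A × Option A)
  pairingA : ∀ a, IsPairing (I.upA a) (partnersA M a) (partnersA N a) (corrA a)
  pairingB : ∀ b, IsPairing (I.upB b) (partnersB M b) (partnersB N b) (corrB b)

/-- The number of votes (for minus against) that `M` gets over `N` under `c`. -/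
def Correspondence.delta {I : QuotaInstance A B} {M N : Finset (A × B)}
    (c : Correspondence I M N) : ℤ :=
  ∑ a, ((c.corrA a).map fun p => vote (I.prefA a) p.1 p.2).sum +
    ∑ b, ((c.corrB b).map fun p => vote (I.prefB b) p.1 p.2).sum

/-- `M` is popular in the set of critical matchings: it is critical, and no critical matching
is more popular than `M` under any correspondence function. -/
def QuotaInstance.IsPopularCritical (I : QuotaInstance A B) (M : Finset (A × B)) : Prop :=
  I.IsCritical M ∧ ∀ N, I.IsCritical N → ∀ c : Correspondence I N M, ¬ 0 < c.delta

end Popularity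

/-! ### The machine model: a unit-cost random access machine with comparison, addition and
truncated subtraction, programmed by structured programs.  The memory consists of natural
number registers and of arrays; a program names only finitely many of them. -/

/-- A memory state. -/
structure State where
  reg : ℕ → ℕ
  arr : ℕ → ℕ → ℕ

def State.setReg (s : State) (x v : ℕ) : State :=
  { s with reg := Function.update s.reg x v }

def State.setArr (s : State) (k i v : ℕ) : State :=
  { s with arr := Function.update s.arr k (Function.update (s.arr k) i v) }

/-- Arithmetic expressions; `get k e` reads the array `k` at the index `e`. -/
inductive Expr where
  | const (n : ℕ)
  | reg (x : ℕ)
  | get (k : ℕ) (e : Expr)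
  | add (e f : Expr)
  | sub (e f : Expr)

def Expr.eval (s : State) : Expr → ℕ
  | const n => n
  | reg x => s.reg x
  | get k e => s.arr k (e.eval s)
  | add e f => e.eval s + f.eval s
  | sub e f => e.eval s - f.eval s

/-- One step for every operation. -/
def Expr.cost : Expr → ℕ
  | const _ => 1
  | reg _ => 1
  | get _ e => e.cost + 1
  | add e f => e.cost + f.cost + 1
  | sub e f => e.cost + f.cost + 1

/-- Tests. -/
inductive Test where
  | lt (e f : Expr)
  | eq (e f : Expr)
  | not (t : Test)
  | and (t u : Test)

def Test.eval (s : State) : Test → Bool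
  | lt e f => decide (e.eval s < f.eval s)
  | eq e f => decide (e.eval s = f.eval s)
  | not t => !(t.eval s)
  | and t u => t.eval s && u.eval s

def Test.cost : Test → ℕ
  | lt e f => e.cost + f.cost + 1
  | eq e f => e.cost + f.cost + 1
  | not t => t.cost + 1
  | and t u => t.cost + u.cost + 1

/-- Programs. -/
inductive Program where
  | skip
  | assign (x : ℕ) (e : Expr)
  | store (k : ℕ) (i e : Expr)
  | seq (p q : Program)
  | branch (t : Test) (p q : Program)
  | loop (t : Test) (p : Program)

/-- `Exec p s s' n`: the program `p`, started in the state `s`, halts in the state `s'` after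
exactly `n` steps.  `loop t p` repeats `p` as long as the test `t` holds. -/
inductive Exec : Program → State → State → ℕ → Prop where
  | skip (s : State) : Exec .skip s s 1
  | assign (x : ℕ) (e : Expr) (s : State) :
      Exec (.assign x e) s (s.setReg x (e.eval s)) (e.cost + 1)
  | store (k : ℕ) (i e : Expr) (s : State) :
      Exec (.store k i e) s (s.setArr k (i.eval s) (e.eval s)) (i.cost + e.cost + 1)
  | seq {p q : Program} {s s' s'' : State} {m n : ℕ} :
      Exec p s s' m → Exec q s' s'' n → Exec (.seq p q) s s'' (m + n)
  | branchTrue {t : Test} {p q : Program} {s s' : State} {n : ℕ} :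
      t.eval s = true → Exec p s s' n → Exec (.branch t p q) s s' (t.cost + n + 1)
  | branchFalse {t : Test} {p q : Program} {s s' : State} {n : ℕ} :
      t.eval s = false → Exec q s s' n → Exec (.branch t p q) s s' (t.cost + n + 1)
  | loopFalse {t : Test} {p : Program} {s : State} :
      t.eval s = false → Exec (.loop t p) s s (t.cost + 1)
  | loopTrue {t : Test} {p : Program} {s s' s'' : State} {m n : ℕ} :
      t.eval s = true → Exec p s s' m → Exec (.loop t p) s' s'' n →
      Exec (.loop t p) s s'' (t.cost + m + n + 1)

/-- The machine is deterministic, so a program has at most one output and one running time. -/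
theorem Exec.deterministic {p : Program} {s s₁ : State} {n₁ : ℕ} (h₁ : Exec p s s₁ n₁) :
    ∀ {s₂ : State} {n₂ : ℕ}, Exec p s s₂ n₂ → s₁ = s₂ ∧ n₁ = n₂ := by
  induction h₁ with
  | skip | assign | store => intro s₂ n₂ h₂; cases h₂; exact ⟨rfl, rfl⟩
  | seq _ _ ih ih' =>
    intro s₂ n₂ h₂
    cases h₂ with
    | seq h h' =>
      obtain ⟨rfl, rfl⟩ := ih h
      obtain ⟨rfl, rfl⟩ := ih' h'
      exact ⟨rfl, rfl⟩
  | branchTrue ht _ ih =>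
    intro s₂ n₂ h₂
    cases h₂ with
    | branchTrue _ h => obtain ⟨rfl, rfl⟩ := ih h; exact ⟨rfl, rfl⟩
    | branchFalse hf _ => simp [ht] at hf
  | branchFalse hf _ ih =>
    intro s₂ n₂ h₂
    cases h₂ with
    | branchTrue ht _ => simp [ht] at hf
    | branchFalse _ h => obtain ⟨rfl, rfl⟩ := ih h; exact ⟨rfl, rfl⟩
  | loopFalse hf =>
    intro s₂ n₂ h₂
    cases h₂ with
    | loopFalse _ => exact ⟨rfl, rfl⟩
    | loopTrue ht _ _ => simp [ht] at hf
  | loopTrue ht _ _ ih ih' =>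
    intro s₂ n₂ h₂
    cases h₂ with
    | loopFalse hf => simp [ht] at hf
    | loopTrue _ h h' =>
      obtain ⟨rfl, rfl⟩ := ih h
      obtain ⟨rfl, rfl⟩ := ih' h'
      exact ⟨rfl, rfl⟩

/-! ### Input and output format -/

section Format

variable {nA nB : ℕ}

/-- The preference lists of the vertices of `A`, as lists of vertex numbers. -/
def QuotaInstance.listsA (I : QuotaInstance (Fin nA) (Fin nB)) : List (List ℕ) :=
  List.ofFn fun a => (I.prefA a).map Fin.val

/-- The preference lists of the vertices of `B`, as lists of vertex numbers. -/
def QuotaInstance.listsB (I : QuotaInstance (Fin nA) (Fin nB)) : List (List ℕ) :=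
  List.ofFn fun b => (I.prefB b).map Fin.val

/-- The position in the concatenation of the lists `L` at which the `i`-th list starts (the total
length if there is no `i`-th list). -/
def startOf (L : List (List ℕ)) (i : ℕ) : ℕ :=
  ((L.take i).map List.length).sum

/-- The array that holds the list `l`, followed by zeros. -/
def arrayOf (l : List ℕ) : ℕ → ℕ := fun i => l.getD i 0

/-- The initial memory.  Registers 0 and 1 hold the numbers of vertices of `A` and `B`; arrays
0 to 3 hold the lower and upper quotas of `A` and of `B`; the preference lists of `A` are
concatenated in array 5, and array 4 holds the starting position of each of them; arrays 6 and 7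
do the same for `B`.  Everything else is zero. -/
def QuotaInstance.encode (I : QuotaInstance (Fin nA) (Fin nB)) : State where
  reg
    | 0 => nA
    | 1 => nB
    | _ => 0
  arr
    | 0 => arrayOf (List.ofFn I.lowA)
    | 1 => arrayOf (List.ofFn I.upA)
    | 2 => arrayOf (List.ofFn I.lowB)
    | 3 => arrayOf (List.ofFn I.upB)
    | 4 => startOf I.listsA
    | 5 => arrayOf I.listsA.flatten
    | 6 => startOf I.listsB
    | 7 => arrayOf I.listsB.flatten
    | _ => fun _ => 0

/-- The set of edges that a final memory describes: array 8 marks the chosen edges by 1, an edge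
`(a, b)` being addressed by the position of `b`, in the list of `a`, in array 5. -/
def QuotaInstance.output (I : QuotaInstance (Fin nA) (Fin nB)) (s : State) :
    Finset (Fin nA × Fin nB) :=
  I.edges.filter fun e => s.arr 8 (startOf I.listsA e.1 + (I.prefA e.1).idxOf e.2) = 1

end Format

end ManyToMany

/-! The proof is LP duality with a certificate made of levels, and the certificate comes from a
deferred acceptance algorithm.

Certificate. Each edge carries two counters: `x a b`, the level up to which `a` has offered it, and
`z a b`, the level up to which `b` has refused it. The matching `M` consists of the edges with `z <
x`. Along each preference list the counters are monotone and differ by at most one. Hence the vote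
of either end for a new partner in `N \ M` against an old one in `M \ N` is at most a difference of
potentials, `2x - (2s+2)` on the new edge and `2z - (2s+1)` on the old one. These potentials enter
with opposite signs at the two ends of an edge and cancel in the sum. Only unfilled positions
contribute, and they give `LevelCertificate.delta_le`: the votes for `N` are at most `2s (deficiency
N - deficiency M)` minus the total surplus of `N` over `M` at the vertices. Every vertex casts at
most as many votes as its degree, so the votes are at least `-2|E|`. With `s = |E| + 1`, a smaller
deficiency of `N` is impossible, so `M` is critical. For critical `N` the bound is nonpositive, so
`M` is popular. If `N` is popular too, its surplus vanishes at every vertex, so `|N| ≤ |M|`.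

Algorithm. Each `a` runs cyclically through its list, best first, raising `x`: up to level `s+2`
while it is below its upper quota, up to `2s+2` while it is below its lower quota. Each `b` runs
cyclically through its list, worst first, raising `z`: at levels below `s` whenever it holds more
than its lower quota, at any level when it holds more than its upper quota. When nobody wants to
move, the counters form a certificate (`LevelInv.levelCertificate`).

Running time. The entry at a pointer has the least level in its list, so it alone decides whether
the vertex wants to move, and a move takes constant time. Every counter stays at most `2s+2`, so
there are `O(|E|²)` moves. Matching up the two copies of each edge by linear search costs `O(|B| +
|E|²)` beforehand, up to an additive constant. -/

namespace ManyToMany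

open Finset

/-! ### Votes and pairings at a single vertex. -/

section Vertex

variable {X : Type*} [DecidableEq X]

theorem neg_one_le_vote (l : List X) (o p : Option X) : -1 ≤ vote l o p := by
  rcases o with _ | o <;> rcases p with _ | p <;> simp only [vote] <;> (try split_ifs) <;> norm_num

theorem vote_swap (l : List X) (o p : Option X) : vote l p o = -vote l o p := by
  rcases o with _ | o <;> rcases p with _ | p <;> simp only [vote] <;> (try split_ifs) <;>
    omega

theorem sum_vote_map_swap (l : List X) (K : Multiset (Option X × Option X)) :
    ((K.map Prod.swap).map fun p => vote l p.1 p.2).sum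
      = -(K.map fun p => vote l p.1 p.2).sum := by
  rw [Multiset.map_map, ← Multiset.sum_map_neg]
  congr 1
  exact Multiset.map_congr rfl fun p _ => vote_swap l p.1 p.2

omit [DecidableEq X] in
theorem card_positions {q : ℕ} {S : Finset X} (h : S.card ≤ q) :
    Multiset.card (positions q S) = q := by
  simp [positions, h]

/-- The unfilled positions cancel like any other element, so only the side with fewer partners keeps
some of them. -/
theorem positions_sub (q : ℕ) (S T : Finset X) :
    positions q S - positions q T =
      (S \ T).val.map some + Multiset.replicate ((q - S.card) - (q - T.card)) none := by
  have inj : Function.Injective (some : X → Option X) := Option.some_injective X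
  ext o
  rcases o with _ | x
  · simp [positions]
  · have h (U : Finset X) : Multiset.count (some x) (U.val.map some) = if x ∈ U then 1 else 0 := by
      rw [Multiset.count_map_eq_count' _ _ inj, Multiset.count_eq_of_nodup U.nodup]
      simp
    simp only [positions, Multiset.count_sub, Multiset.count_add, h, Multiset.count_replicate,
      Finset.mem_sdiff]
    by_cases h1 : x ∈ S <;> by_cases h2 : x ∈ T <;> simp [h1, h2]

theorem sum_map_positions_sub (q : ℕ) (S T : Finset X) (W : Option X → ℤ) :
    ((positions q S - positions q T).map W).sum =
      ∑ u ∈ S \ T, W (some u) + (((q - S.card) - (q - T.card) : ℕ) : ℤ) * W none := by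
  rw [positions_sub]
  simp [Finset.sum]

theorem IsPairing.swap {q : ℕ} {S T : Finset X} {K : Multiset (Option X × Option X)}
    (h : IsPairing q S T K) : IsPairing q T S (K.map Prod.swap) := by
  refine ⟨?_, ?_⟩
  · rw [Multiset.map_map, ← h.2]; rfl
  · rw [Multiset.map_map, ← h.1]; rfl

/-- Both position multisets have size `q`, so the two differences have equal size, and any two
enumerations of them can be zipped. -/
theorem exists_isPairing {q : ℕ} {S T : Finset X} (hS : S.card ≤ q) (hT : T.card ≤ q) :
    ∃ K, IsPairing q S T K := by
  have hcard : Multiset.card (positions q S - positions q T) =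
      Multiset.card (positions q T - positions q S) := by
    have h1 := congrArg Multiset.card (Multiset.sub_add_inter (positions q S) (positions q T))
    have h2 := congrArg Multiset.card (Multiset.sub_add_inter (positions q T) (positions q S))
    rw [Multiset.card_add, card_positions hS] at h1
    rw [Multiset.card_add, card_positions hT, Multiset.inter_comm] at h2
    omega
  refine ⟨((positions q S - positions q T).toList.zip (positions q T - positions q S).toList :
    List _), ?_, ?_⟩
  · rw [Multiset.map_coe, List.map_fst_zip (by simp [hcard]), Multiset.coe_toList]
  · rw [Multiset.map_coe, List.map_snd_zip (by simp [hcard]), Multiset.coe_toList]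

theorem IsPairing.card_le {q : ℕ} {S T : Finset X} {K : Multiset (Option X × Option X)}
    (h : IsPairing q S T K) (U : Finset X) (hS : S ⊆ U) (hT : T ⊆ U)
    (hTq : T.card ≤ q) : Multiset.card K ≤ U.card := by
  have h1 := congrArg Multiset.card h.1
  rw [Multiset.card_map, positions_sub] at h1
  simp only [Multiset.card_add, Multiset.card_map, Finset.card_val, Multiset.card_replicate] at h1
  have h2 := Finset.card_sdiff_add_card_inter S T
  have h3 := Finset.card_le_card (Finset.inter_subset_left : S ∩ T ⊆ S)
  have := Finset.card_le_card hS
  have := Finset.card_le_card hT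
  omega

theorem neg_card_le_sum_vote (l : List X) (K : Multiset (Option X × Option X)) :
    -(Multiset.card K : ℤ) ≤ (K.map fun p => vote l p.1 p.2).sum := by
  induction K using Multiset.induction_on with
  | empty => simp
  | cons p K ih =>
    have := neg_one_le_vote l p.1 p.2
    simp only [Multiset.card_cons, Multiset.map_cons, Multiset.sum_cons]
    push_cast
    linarith

/-- Weak duality at one vertex: the votes are bounded by a difference of potentials. -/
theorem IsPairing.sum_vote_le_potential {q : ℕ} {S T : Finset X}
    {K : Multiset (Option X × Option X)} (h : IsPairing q S T K) (l : List X)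
    (W Y : Option X → ℤ)
    (hWY : ∀ o ∈ positions q S - positions q T, ∀ p ∈ positions q T - positions q S,
      vote l o p ≤ W o - Y p) :
    (K.map fun p => vote l p.1 p.2).sum ≤
      ∑ u ∈ S \ T, W (some u) + (((q - S.card) - (q - T.card) : ℕ) : ℤ) * W none
      - (∑ u ∈ T \ S, Y (some u) + (((q - T.card) - (q - S.card) : ℕ) : ℤ) * Y none) := by
  rw [← sum_map_positions_sub, ← sum_map_positions_sub, ← h.1, ← h.2, Multiset.map_map,
    Multiset.map_map, ← Multiset.sum_map_sub]
  refine Multiset.sum_map_le_sum_map _ _ fun p hp => ?_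
  exact hWY _ (h.1 ▸ Multiset.mem_map_of_mem _ hp) _ (h.2 ▸ Multiset.mem_map_of_mem _ hp)

theorem some_mem_positions_sub {q : ℕ} {S T : Finset X} {u : X}
    (h : some u ∈ positions q S - positions q T) : u ∈ S \ T := by
  rw [positions_sub] at h
  simpa [Multiset.mem_replicate, ← Finset.sdiff_val, -Finset.sdiff_val] using h

theorem none_mem_positions_sub {q : ℕ} {S T : Finset X}
    (h : none ∈ positions q S - positions q T) : S.card < T.card := by
  rw [positions_sub] at h
  simp [Multiset.mem_replicate] at h
  omega

/-- Weak duality with suitable prices for the unfilled positions. Here `T` is the certified partner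
set and `S` the competitor. The part of the price that depends on `low` pays for the change in
deficiency, and the remaining unit per newly filled position gives the surplus term. -/
theorem IsPairing.sum_vote_le {q low s : ℕ} {S T : Finset X}
    {K : Multiset (Option X × Option X)} (h : IsPairing q S T K) (l : List X) (w y : X → ℤ)
    (hS : S.card ≤ q) (hT : T.card ≤ q)
    (hv : ∀ u ∈ S \ T, ∀ t ∈ T \ S, vote l (some u) (some t) ≤ w u - y t)
    (hup : T.card < q → ∀ u ∈ S \ T, 2 ≤ w u)
    (hlow : T.card < low → ∀ u ∈ S \ T, 2 * (s : ℤ) + 2 ≤ w u)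
    (hy : ∀ t ∈ T \ S, y t ≤ 2 * s + 1)
    (hy' : low < T.card → ∀ t ∈ T \ S, y t ≤ 1) :
    (K.map fun p => vote l p.1 p.2).sum ≤
      ∑ u ∈ S \ T, w u - ∑ t ∈ T \ S, y t
        + 2 * s * (((low - S.card : ℕ) : ℤ) - ((low - T.card : ℕ) : ℤ))
        - ((S.card - T.card : ℕ) : ℤ) := by
  rcases lt_or_ge T.card S.card with hlt | hge
  · have hTq : T.card < q := lt_of_lt_of_le hlt hS
    -- The vacancies are on the side of `T`. A new partner gets vote 1 against a vacancy, and `hup`,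
    -- `hlow` make its potential exceed this price by at least 1.
    set c : ℤ := if T.card < low then 2 * s + 1 else 1 with hc
    have key := h.sum_vote_le_potential l (fun o => o.elim 0 w) (fun o => o.elim c y) ?_
    · refine key.trans ?_
      have e1 : (q - S.card) - (q - T.card) = 0 := by omega
      have e2 : (q - T.card) - (q - S.card) = S.card - T.card := by omega
      rw [e1, e2]
      simp only [Option.elim, Nat.cast_zero, zero_mul, add_zero]
      have h1 : 2 * (s : ℤ) * (((low - T.card : ℕ) : ℤ) - ((low - S.card : ℕ) : ℤ))
          ≤ ((S.card - T.card : ℕ) : ℤ) * (c - 1) := by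
        by_cases hl : T.card < low
        · rw [hc, if_pos hl, mul_comm, add_sub_cancel_right]
          exact mul_le_mul_of_nonneg_right (by omega) (by positivity)
        · have : low - T.card = 0 := by omega
          have : low - S.card = 0 := by omega
          simp [*]
      linarith
    · intro o ho p hp
      rcases o with _ | u
      · exact absurd (none_mem_positions_sub ho) (by omega)
      have hu := some_mem_positions_sub ho
      rcases p with _ | t
      · change (1 : ℤ) ≤ w u - c
        have := hup hTq u hu
        rw [hc]
        split_ifs with hl
        · linarith [hlow hl u hu]
        · linarith
      · exact hv u hu t (some_mem_positions_sub hp)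
  -- The vacancies are on the side of `S`. A vacancy gets vote -1 against an old partner, and `hy`,
  -- `hy'` keep the potential of that partner within 1 of this price.
  · set c : ℤ := if low < T.card then 0 else 2 * s with hc
    have key := h.sum_vote_le_potential l (fun o => o.elim c w) (fun o => o.elim 0 y) ?_
    · refine key.trans ?_
      have e1 : (q - S.card) - (q - T.card) = T.card - S.card := by omega
      have e2 : (q - T.card) - (q - S.card) = 0 := by omega
      have e3 : S.card - T.card = 0 := by omega
      rw [e1, e2, e3]
      simp only [Option.elim, Nat.cast_zero, zero_mul, add_zero]
      have h1 : ((T.card - S.card : ℕ) : ℤ) * c ≤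
          2 * (s : ℤ) * (((low - S.card : ℕ) : ℤ) - ((low - T.card : ℕ) : ℤ)) := by
        by_cases hl : low < T.card
        · rw [hc, if_pos hl, mul_zero]
          exact mul_nonneg (by positivity) (by omega)
        · rw [hc, if_neg hl, mul_comm]
          exact mul_le_mul_of_nonneg_left (by omega) (by positivity)
      linarith
    · intro o ho p hp
      rcases p with _ | t
      · exact absurd (none_mem_positions_sub hp) (by omega)
      have ht := some_mem_positions_sub hp
      rcases o with _ | u
      · change (-1 : ℤ) ≤ c - y t
        have := hy t ht
        rw [hc]
        split_ifs with hl
        · linarith [hy' hl t ht]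
        · linarith
      · exact hv u (some_mem_positions_sub ho) t ht

end Vertex

/-! ### Weak duality for whole matchings, and what a level certificate implies. -/

section Global

variable {A B : Type*} [Fintype A] [Fintype B] [DecidableEq A] [DecidableEq B]

omit [Fintype A] in
theorem mem_partnersA {M : Finset (A × B)} {a : A} {b : B} :
    b ∈ partnersA M a ↔ (a, b) ∈ M := by simp [partnersA]

omit [Fintype B] in
theorem mem_partnersB {M : Finset (A × B)} {a : A} {b : B} :
    a ∈ partnersB M b ↔ (a, b) ∈ M := by simp [partnersB]

omit [DecidableEq A] in
theorem QuotaInstance.mem_edges {I : QuotaInstance A B} {a : A} {b : B} :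
    (a, b) ∈ I.edges ↔ b ∈ I.prefA a := by simp [edges]

omit [Fintype A] in
theorem partnersA_sdiff (M N : Finset (A × B)) (a : A) :
    partnersA (M \ N) a = partnersA M a \ partnersA N a := by
  ext b; simp [mem_partnersA]

omit [Fintype B] in
theorem partnersB_sdiff (M N : Finset (A × B)) (b : B) :
    partnersB (M \ N) b = partnersB M b \ partnersB N b := by
  ext a; simp [mem_partnersB]

omit [Fintype A] in
theorem partnersA_mono {M N : Finset (A × B)} (h : M ⊆ N) (a : A) :
    partnersA M a ⊆ partnersA N a := fun b hb => by
  rw [mem_partnersA] at *; exact h hb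

omit [Fintype B] in
theorem partnersB_mono {M N : Finset (A × B)} (h : M ⊆ N) (b : B) :
    partnersB M b ⊆ partnersB N b := fun a ha => by
  rw [mem_partnersB] at *; exact h ha

theorem sum_partnersA {R : Type*} [AddCommMonoid R] (M : Finset (A × B)) (w : A → B → R) :
    ∑ a, ∑ b ∈ partnersA M a, w a b = ∑ e ∈ M, w e.1 e.2 := by
  simp only [partnersA, Finset.sum_filter]
  rw [← Finset.sum_product', Finset.univ_product_univ, ← Finset.sum_filter]
  simp

theorem sum_partnersB {R : Type*} [AddCommMonoid R] (M : Finset (A × B)) (w : A → B → R) :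
    ∑ b, ∑ a ∈ partnersB M b, w a b = ∑ e ∈ M, w e.1 e.2 := by
  rw [← sum_partnersA]
  simp only [partnersA, partnersB, Finset.sum_filter]
  exact Finset.sum_comm

theorem sum_card_partnersA (M : Finset (A × B)) : ∑ a, (partnersA M a).card = M.card := by
  simpa only [Finset.card_eq_sum_ones] using sum_partnersA M fun _ _ => 1

theorem sum_card_partnersB (M : Finset (A × B)) : ∑ b, (partnersB M b).card = M.card := by
  simpa only [Finset.card_eq_sum_ones] using sum_partnersB M fun _ _ => 1

def Correspondence.symm {I : QuotaInstance A B} {M N : Finset (A × B)}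
    (c : Correspondence I M N) : Correspondence I N M where
  corrA a := (c.corrA a).map Prod.swap
  corrB b := (c.corrB b).map Prod.swap
  pairingA a := (c.pairingA a).swap
  pairingB b := (c.pairingB b).swap

theorem Correspondence.delta_symm {I : QuotaInstance A B} {M N : Finset (A × B)}
    (c : Correspondence I M N) : c.symm.delta = -c.delta := by
  have hA := fun a => sum_vote_map_swap (I.prefA a) (c.corrA a)
  have hB := fun b => sum_vote_map_swap (I.prefB b) (c.corrB b)
  simp only [delta, symm, hA, hB, Finset.sum_neg_distrib]
  ring

theorem QuotaInstance.IsMatching.nonempty_correspondence {I : QuotaInstance A B}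
    {M N : Finset (A × B)} (hM : I.IsMatching M) (hN : I.IsMatching N) :
    Nonempty (Correspondence I M N) := by
  choose KA hKA using fun a => exists_isPairing (hM.2.1 a) (hN.2.1 a)
  choose KB hKB using fun b => exists_isPairing (hM.2.2 b) (hN.2.2 b)
  exact ⟨⟨KA, KB, hKA, hKB⟩⟩

/-- A vertex exchanges at most as many positions as it has neighbours, and the degrees on each side
add up to the number of edges. -/
theorem Correspondence.neg_le_delta {I : QuotaInstance A B} {M N : Finset (A × B)}
    (hM : I.IsMatching M) (hN : I.IsMatching N) (c : Correspondence I M N) :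
    -(2 * (I.edges.card : ℤ)) ≤ c.delta := by
  have hA : -(I.edges.card : ℤ) ≤
      ∑ a, ((c.corrA a).map fun p => vote (I.prefA a) p.1 p.2).sum := by
    rw [← sum_card_partnersA]
    push_cast
    rw [← Finset.sum_neg_distrib]
    refine Finset.sum_le_sum fun a _ => le_trans ?_ (neg_card_le_sum_vote _ _)
    have := (c.pairingA a).card_le _ (partnersA_mono hM.1 a) (partnersA_mono hN.1 a) (hN.2.1 a)
    omega
  have hB : -(I.edges.card : ℤ) ≤
      ∑ b, ((c.corrB b).map fun p => vote (I.prefB b) p.1 p.2).sum := by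
    rw [← sum_card_partnersB]
    push_cast
    rw [← Finset.sum_neg_distrib]
    refine Finset.sum_le_sum fun b _ => le_trans ?_ (neg_card_le_sum_vote _ _)
    have := (c.pairingB b).card_le _ (partnersB_mono hM.1 b) (partnersB_mono hN.1 b) (hN.2.2 b)
    omega
  unfold delta
  linarith

/-- Levels that certify the optimality of a matching `M`: an edge `(a, b)` of `M` has level
`z a b`, while an edge outside `M` has been refused at all levels below `x a b`. -/
structure LevelCertificate (I : QuotaInstance A B) (M : Finset (A × B)) (s : ℕ)
    (x z : A → B → ℕ) : Prop where
  isMatching : I.IsMatching M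
  lt_of_mem : ∀ a b, (a, b) ∈ M → z a b < x a b
  le_of_notMem : ∀ a b, b ∈ I.prefA a → (a, b) ∉ M → x a b ≤ z a b
  x_le : ∀ a b, b ∈ I.prefA a → x a b ≤ 2 * s + 2
  x_mono : ∀ a, ∀ b ∈ I.prefA a, ∀ b' ∈ I.prefA a,
    (I.prefA a).idxOf b < (I.prefA a).idxOf b' → x a b' ≤ x a b ∧ x a b ≤ x a b' + 1
  z_mono : ∀ b, ∀ a ∈ I.prefB b, ∀ a' ∈ I.prefB b,
    (I.prefB b).idxOf a < (I.prefB b).idxOf a' → z a b ≤ z a' b ∧ z a' b ≤ z a b + 1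
  x_of_lt_up : ∀ a, (partnersA M a).card < I.upA a → ∀ b ∈ I.prefA a, s + 2 ≤ x a b
  x_of_lt_low : ∀ a, (partnersA M a).card < I.lowA a → ∀ b ∈ I.prefA a, x a b = 2 * s + 2
  z_of_low_lt : ∀ a, I.lowA a < (partnersA M a).card → ∀ b, (a, b) ∈ M → z a b ≤ s + 1
  z_of_lt_up : ∀ b, (partnersB M b).card < I.upB b → ∀ a ∈ I.prefB b, z a b ≤ s
  z_of_lt_low : ∀ b, (partnersB M b).card < I.lowB b → ∀ a ∈ I.prefB b, z a b = 0
  z_of_low_lt' : ∀ b, I.lowB b < (partnersB M b).card → ∀ a, (a, b) ∈ M → s ≤ z a b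

theorem idxOf_lt_or_gt {X : Type*} [DecidableEq X] {l : List X} {u t : X} (hu : u ∈ l)
    (h : u ≠ t) : l.idxOf u < l.idxOf t ∨ l.idxOf t < l.idxOf u :=
  lt_or_gt_of_ne fun h' => h ((List.idxOf_inj hu).1 h')

/-- `IsPairing.sum_vote_le` is applied at every vertex, with potentials `w`, `y` on the `A`-side and
`-w`, `-y` on the `B`-side. -/
theorem LevelCertificate.delta_le {I : QuotaInstance A B} {M N : Finset (A × B)} {s : ℕ}
    {x z : A → B → ℕ} (h : LevelCertificate I M s x z) (hN : I.IsMatching N)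
    (c : Correspondence I N M) :
    c.delta ≤ 2 * s * ((I.deficiency N : ℤ) - I.deficiency M)
      - ∑ a, (((partnersA N a).card - (partnersA M a).card : ℕ) : ℤ)
      - ∑ b, (((partnersB N b).card - (partnersB M b).card : ℕ) : ℤ) := by
  -- The opposite parities make `w - y` odd, so a comparison of levels becomes a bound by 1 or -1.
  -- The shifts turn the thresholds `s + 2` and `2s + 2` for `x` into 2 and `2s + 2` for `w`, and
  -- `s` and `0` into the same values for `-w`; `z ≤ s + 1` becomes `y ≤ 1`, and `s ≤ z` becomes `-y
  -- ≤ 1`.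
  set w : A → B → ℤ := fun a b => 2 * x a b - (2 * s + 2) with hw
  set y : A → B → ℤ := fun a b => 2 * z a b - (2 * s + 1) with hy
  have memN {a b} (hb : (a, b) ∈ N) : b ∈ I.prefA a := QuotaInstance.mem_edges.1 (hN.1 hb)
  have memM {a b} (hb : (a, b) ∈ M) : b ∈ I.prefA a :=
    QuotaInstance.mem_edges.1 (h.isMatching.1 hb)
  have hA (a : A) := (c.pairingA a).sum_vote_le (low := I.lowA a) (s := s) (I.prefA a) (w a) (y a)
    (hN.2.1 a) (h.isMatching.2.1 a)
    (by
      intro u hu t ht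
      simp only [mem_sdiff, mem_partnersA] at hu ht
      have hut : u ≠ t := fun e => hu.2 (e ▸ ht.1)
      have hzt := h.lt_of_mem a t ht.1
      simp only [vote, hw, hy]
      rcases idxOf_lt_or_gt (memN hu.1) hut with hlt | hlt
      · have := h.x_mono a u (memN hu.1) t (memM ht.1) hlt
        rw [if_pos hlt]
        omega
      · have := h.x_mono a t (memM ht.1) u (memN hu.1) hlt
        rw [if_neg hlt.not_gt, if_pos hlt]
        omega)
    (by
      intro hlt u hu
      simp only [mem_sdiff, mem_partnersA] at hu
      have := h.x_of_lt_up a hlt u (memN hu.1)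
      simp only [hw]; omega)
    (by
      intro hlt u hu
      simp only [mem_sdiff, mem_partnersA] at hu
      have := h.x_of_lt_low a hlt u (memN hu.1)
      simp only [hw]; omega)
    (by
      intro t ht
      simp only [mem_sdiff, mem_partnersA] at ht
      have := h.x_le a t (memM ht.1)
      have := h.lt_of_mem a t ht.1
      simp only [hy]; omega)
    (by
      intro hlt t ht
      simp only [mem_sdiff, mem_partnersA] at ht
      have := h.z_of_low_lt a hlt t ht.1
      simp only [hy]; omega)
  have hB (b : B) := (c.pairingB b).sum_vote_le (low := I.lowB b) (s := s) (I.prefB b)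
    (fun a => -w a b) (fun a => -y a b)
    (hN.2.2 b) (h.isMatching.2.2 b)
    (by
      intro u hu t ht
      simp only [mem_sdiff, mem_partnersB] at hu ht
      have hut : u ≠ t := fun e => hu.2 (e ▸ ht.1)
      have hzu := h.le_of_notMem u b (memN hu.1) hu.2
      have hu' := (I.mem_prefA_iff u b).1 (memN hu.1)
      have ht' := (I.mem_prefA_iff t b).1 (memM ht.1)
      simp only [vote, hw, hy]
      rcases idxOf_lt_or_gt hu' hut with hlt | hlt
      · have := h.z_mono b u hu' t ht' hlt
        rw [if_pos hlt]
        omega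
      · have := h.z_mono b t ht' u hu' hlt
        rw [if_neg hlt.not_gt, if_pos hlt]
        omega)
    (by
      intro hlt u hu
      simp only [mem_sdiff, mem_partnersB] at hu
      have := h.z_of_lt_up b hlt u ((I.mem_prefA_iff u b).1 (memN hu.1))
      have := h.le_of_notMem u b (memN hu.1) hu.2
      simp only [hw]; omega)
    (by
      intro hlt u hu
      simp only [mem_sdiff, mem_partnersB] at hu
      have := h.z_of_lt_low b hlt u ((I.mem_prefA_iff u b).1 (memN hu.1))
      have := h.le_of_notMem u b (memN hu.1) hu.2
      simp only [hw]; omega)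
    (by
      intro t ht
      simp only [hy]; omega)
    (by
      intro hlt t ht
      simp only [mem_sdiff, mem_partnersB] at ht
      have := h.z_of_low_lt' b hlt t ht.1
      simp only [hy]; omega)
  have sA := Finset.sum_le_sum fun a (_ : a ∈ Finset.univ) => hA a
  have sB := Finset.sum_le_sum fun b (_ : b ∈ Finset.univ) => hB b
  simp only [Finset.sum_sub_distrib, Finset.sum_add_distrib, ← Finset.mul_sum,
    Finset.sum_neg_distrib, ← partnersA_sdiff, ← partnersB_sdiff] at sA sB
  -- Regrouped by edges, the potential sums of the two sides are negatives of each other.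
  rw [sum_partnersA, sum_partnersA] at sA
  rw [sum_partnersB (N \ M) w, sum_partnersB (M \ N) y] at sB
  unfold Correspondence.delta QuotaInstance.deficiency
  push_cast
  linarith

/-- One unit of deficiency is worth `2s` votes, more than the `2|E|` that can be lost altogether. -/
theorem LevelCertificate.isCritical {I : QuotaInstance A B} {M : Finset (A × B)} {s : ℕ}
    {x z : A → B → ℕ} (h : LevelCertificate I M s x z) (hs : I.edges.card < s) :
    I.IsCritical M := by
  refine ⟨h.isMatching, fun N hN => ?_⟩
  by_contra! hlt
  obtain ⟨c⟩ := hN.nonempty_correspondence h.isMatching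
  have h1 := h.delta_le hN c
  have h2 := c.neg_le_delta hN h.isMatching
  have h3 : (0 : ℤ) ≤ ∑ a, (((partnersA N a).card - (partnersA M a).card : ℕ) : ℤ) := by positivity
  have h4 : (0 : ℤ) ≤ ∑ b, (((partnersB N b).card - (partnersB M b).card : ℕ) : ℤ) := by positivity
  have h5 : (I.deficiency N : ℤ) - I.deficiency M ≤ -1 := by omega
  have h6 : 2 * (s : ℤ) * ((I.deficiency N : ℤ) - I.deficiency M) ≤ 2 * s * (-1) :=
    mul_le_mul_of_nonneg_left h5 (by positivity)
  have h7 : (I.edges.card : ℤ) < s := by exact_mod_cast hs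
  linarith

theorem LevelCertificate.delta_le_of_isCritical {I : QuotaInstance A B} {M N : Finset (A × B)}
    {s : ℕ} {x z : A → B → ℕ} (h : LevelCertificate I M s x z) (hN : I.IsCritical N)
    (c : Correspondence I N M) :
    c.delta ≤ - ∑ a, (((partnersA N a).card - (partnersA M a).card : ℕ) : ℤ)
      - ∑ b, (((partnersB N b).card - (partnersB M b).card : ℕ) : ℤ) := by
  have h1 := h.delta_le hN.1 c
  have h5 : (I.deficiency N : ℤ) - I.deficiency M ≤ 0 := by have := hN.2 M h.isMatching; omega
  have h6 : 2 * (s : ℤ) * ((I.deficiency N : ℤ) - I.deficiency M) ≤ 2 * s * 0 :=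
    mul_le_mul_of_nonneg_left h5 (by positivity)
  linarith

theorem LevelCertificate.isPopularCritical {I : QuotaInstance A B} {M : Finset (A × B)} {s : ℕ}
    {x z : A → B → ℕ} (h : LevelCertificate I M s x z) (hs : I.edges.card < s) :
    I.IsPopularCritical M := by
  refine ⟨h.isCritical hs, fun N hN c => ?_⟩
  have h1 := h.delta_le_of_isCritical hN c
  have h3 : (0 : ℤ) ≤ ∑ a, (((partnersA N a).card - (partnersA M a).card : ℕ) : ℤ) := by positivity
  have h4 : (0 : ℤ) ≤ ∑ b, (((partnersB N b).card - (partnersB M b).card : ℕ) : ℤ) := by positivity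
  linarith

/-- Two popular critical matchings tie under every correspondence, so the surplus of `N` in the
duality bound must vanish; the `A`-side alone gives the inequality of sizes. -/
theorem LevelCertificate.card_le {I : QuotaInstance A B} {M N : Finset (A × B)} {s : ℕ}
    {x z : A → B → ℕ} (h : LevelCertificate I M s x z) (hs : I.edges.card < s)
    (hN : I.IsPopularCritical N) : N.card ≤ M.card := by
  obtain ⟨c⟩ := hN.1.1.nonempty_correspondence h.isMatching
  have h1 := h.delta_le_of_isCritical hN.1 c
  have h2 := hN.2 M (h.isCritical hs) c.symm
  rw [c.delta_symm] at h2
  have h4 : (0 : ℤ) ≤ ∑ b, (((partnersB N b).card - (partnersB M b).card : ℕ) : ℤ) := by positivity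
  have h5 : ∑ a, ((partnersA N a).card - (partnersA M a).card) = 0 := by
    zify; refine le_antisymm (by linarith) (by positivity)
  rw [Finset.sum_eq_zero_iff] at h5
  rw [← sum_card_partnersA, ← sum_card_partnersA]
  exact Finset.sum_le_sum fun a _ => by have := h5 a (Finset.mem_univ a); omega

end Global

end ManyToMany

namespace ManyToMany

open Finset

/-! ### Cyclic pointers, level counters and their effect on sets of edges. -/

section Pointer

variable {X : Type*} [DecidableEq X]

/-- The entries before the pointer are one level ahead. Raising the entry at the pointer moves this
boundary by one; at the end of the list the whole list has reached the next level and the pointer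
returns to 0. -/
theorem exists_level_of_advance {l : List X} {p lev : ℕ} {u : X} {f : X → ℕ}
    (hp : l.idxOf u = p) (hf : ∀ v ∈ l, f v = lev + if l.idxOf v < p then 1 else 0) :
    ∃ lev', ∀ v ∈ l, (f v + if v = u then 1 else 0) =
      lev' + if l.idxOf v < (if p + 1 = l.length then 0 else p + 1) then 1 else 0 := by
  have key (v) (hv : v ∈ l) : v = u ↔ l.idxOf v = p := by
    rw [← hp, List.idxOf_inj hv]
  by_cases h : p + 1 = l.length
  · refine ⟨lev + 1, fun v hv => ?_⟩
    have := List.idxOf_lt_length_iff.2 hv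
    rw [hf v hv]
    simp only [key v hv, if_pos h]
    split_ifs <;> omega
  · refine ⟨lev, fun v hv => ?_⟩
    rw [hf v hv]
    simp only [key v hv, if_neg h]
    split_ifs <;> omega

/-- The mirror image for the `B`-side, where `r` counts the entries at the end of the list that are
already ahead. -/
theorem exists_level_of_advance_reverse {l : List X} {r lev : ℕ} {u : X} {f : X → ℕ}
    (hr : l.idxOf u + r + 1 = l.length)
    (hf : ∀ v ∈ l, f v = lev + if l.length ≤ l.idxOf v + r then 1 else 0) :
    ∃ lev', ∀ v ∈ l, (f v + if v = u then 1 else 0) =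
      lev' + if l.length ≤ l.idxOf v + (if l.idxOf u = 0 then 0 else r + 1) then 1 else 0 := by
  have key (v) (hv : v ∈ l) : v = u ↔ l.idxOf v = l.idxOf u := by
    rw [List.idxOf_inj hv]
  by_cases h : l.idxOf u = 0
  · refine ⟨lev + 1, fun v hv => ?_⟩
    have := List.idxOf_lt_length_iff.2 hv
    rw [hf v hv]
    simp only [key v hv, if_pos h]
    split_ifs <;> omega
  · refine ⟨lev, fun v hv => ?_⟩
    rw [hf v hv]
    simp only [key v hv, if_neg h]
    split_ifs <;> omega

end Pointer

variable {A B : Type*} [DecidableEq A] [DecidableEq B]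

/-- Raise the value of `x` at `(a, b)` by one. -/
def bump (x : A → B → ℕ) (a : A) (b : B) : A → B → ℕ :=
  fun a' b' => x a' b' + if a' = a ∧ b' = b then 1 else 0

theorem bump_self (x : A → B → ℕ) (a : A) (b : B) : bump x a b a b = x a b + 1 := by
  simp [bump]

theorem bump_row (x : A → B → ℕ) (a : A) (b b' : B) :
    bump x a b a b' = x a b' + if b' = b then 1 else 0 := by
  simp [bump]

theorem bump_col (x : A → B → ℕ) (a a' : A) (b : B) :
    bump x a b a' b = x a' b + if a' = a then 1 else 0 := by
  simp [bump]

theorem bump_of_ne_left (x : A → B → ℕ) {a a' : A} (h : a' ≠ a) (b b' : B) :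
    bump x a b a' b' = x a' b' := by
  simp [bump, h]

theorem bump_of_ne_right (x : A → B → ℕ) (a a' : A) {b b' : B} (h : b' ≠ b) :
    bump x a b a' b' = x a' b' := by
  simp [bump, h]

theorem sum_sub_bump {E : Finset (A × B)} {x : A → B → ℕ} {a : A} {b : B} {K : ℕ}
    (h : (a, b) ∈ E) (hK : x a b < K) :
    ∑ e ∈ E, (K - bump x a b e.1 e.2) + 1 = ∑ e ∈ E, (K - x e.1 e.2) := by
  rw [← Finset.add_sum_erase E _ h, ← Finset.add_sum_erase E (fun e => K - x e.1 e.2) h]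
  have : ∑ e ∈ E.erase (a, b), (K - bump x a b e.1 e.2) = ∑ e ∈ E.erase (a, b), (K - x e.1 e.2) :=
    Finset.sum_congr rfl fun e he => by
      have hne : ¬ (e.1 = a ∧ e.2 = b) := fun h' => (Finset.mem_erase.1 he).1 (Prod.ext h'.1 h'.2)
      simp [bump, hne]
  rw [this]
  simp only [bump_self]
  omega

variable [Fintype A] [Fintype B]

omit [Fintype A] in
theorem card_partnersA_insert {M : Finset (A × B)} {a : A} {b : B} (h : (a, b) ∉ M) (a' : A) :
    (partnersA (insert (a, b) M) a').card = (partnersA M a').card + if a' = a then 1 else 0 := by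
  by_cases ha : a' = a
  · subst ha
    have : partnersA (insert (a', b) M) a' = insert b (partnersA M a') := by
      ext; simp [mem_partnersA]
    rw [this, Finset.card_insert_of_notMem (by rwa [mem_partnersA]), if_pos rfl]
  · have : partnersA (insert (a, b) M) a' = partnersA M a' := by
      ext; simp [mem_partnersA, ha]
    rw [this, if_neg ha, add_zero]

omit [Fintype B] in
theorem card_partnersB_insert {M : Finset (A × B)} {a : A} {b : B} (h : (a, b) ∉ M) (b' : B) :
    (partnersB (insert (a, b) M) b').card = (partnersB M b').card + if b' = b then 1 else 0 := by
  by_cases hb : b' = b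
  · subst hb
    have : partnersB (insert (a, b') M) b' = insert a (partnersB M b') := by
      ext; simp [mem_partnersB]
    rw [this, Finset.card_insert_of_notMem (by rwa [mem_partnersB]), if_pos rfl]
  · have : partnersB (insert (a, b) M) b' = partnersB M b' := by
      ext; simp [mem_partnersB, hb]
    rw [this, if_neg hb, add_zero]

omit [Fintype A] in
theorem card_partnersA_erase {M : Finset (A × B)} {a : A} {b : B} (h : (a, b) ∈ M) (a' : A) :
    (partnersA M a').card = (partnersA (M.erase (a, b)) a').card + if a' = a then 1 else 0 := by
  rw [← card_partnersA_insert (Finset.notMem_erase _ _), Finset.insert_erase h]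

omit [Fintype B] in
theorem card_partnersB_erase {M : Finset (A × B)} {a : A} {b : B} (h : (a, b) ∈ M) (b' : B) :
    (partnersB M b').card = (partnersB (M.erase (a, b)) b').card + if b' = b then 1 else 0 := by
  rw [← card_partnersB_insert (Finset.notMem_erase _ _), Finset.insert_erase h]

/-! ### The level-wise proposal algorithm in the abstract. -/

namespace QuotaInstance

variable (I : QuotaInstance A B)

/-- The edges that have been offered once more than refused: `x` counts the levels up to which
the `A`-side has offered an edge, `z` the levels up to which the `B`-side has refused it. -/
def held (x z : A → B → ℕ) : Finset (A × B) :=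
  I.edges.filter fun e => z e.1 e.2 < x e.1 e.2

variable {I}

omit [DecidableEq A] in
theorem mem_held {x z : A → B → ℕ} {a : A} {b : B} :
    (a, b) ∈ I.held x z ↔ b ∈ I.prefA a ∧ z a b < x a b := by
  simp [held, mem_edges]

/-- An offer changes the held set only when it overtakes the refusals: with `x < z` it has been
refused in advance, and with `z < x` the edge is held already. -/
theorem held_bump_left {x z : A → B → ℕ} {a : A} {b : B} (hb : b ∈ I.prefA a) :
    I.held (bump x a b) z = if x a b = z a b then insert (a, b) (I.held x z) else I.held x z := by
  ext ⟨a', b'⟩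
  by_cases h : a' = a ∧ b' = b
  · obtain ⟨rfl, rfl⟩ := h
    rw [mem_held, bump_self]
    split_ifs with hxz
    · simp [hb, hxz]
    · simp [mem_held, hb]; omega
  · rw [mem_held]
    split_ifs <;> simp [mem_held, bump, h]

theorem held_bump_right {x z : A → B → ℕ} {a : A} {b : B} :
    I.held x (bump z a b) =
      if x a b = z a b + 1 then (I.held x z).erase (a, b) else I.held x z := by
  ext ⟨a', b'⟩
  by_cases h : a' = a ∧ b' = b
  · obtain ⟨rfl, rfl⟩ := h
    rw [mem_held, bump_self]
    split_ifs with hxz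
    · simp [hxz]
    · rw [mem_held, show z a' b' + 1 < x a' b' ↔ z a' b' < x a' b' by omega]
  · rw [mem_held]
    split_ifs <;> simp [mem_held, bump, h]

variable (I)

/-- The vertex `a` wants to make another offer, at the level of `b`. -/
def WantsA (s : ℕ) (x z : A → B → ℕ) (a : A) (b : B) : Prop :=
  ((partnersA (I.held x z) a).card < I.upA a ∧ x a b < s + 2) ∨
    ((partnersA (I.held x z) a).card < I.lowA a ∧ x a b < 2 * s + 2)

/-- The vertex `b` wants to refuse another offer, at the level of `a`. -/
def WantsB (s : ℕ) (x z : A → B → ℕ) (b : B) (a : A) : Prop :=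
  (I.lowB b < (partnersB (I.held x z) b).card ∧ z a b < s) ∨
    I.upB b < (partnersB (I.held x z) b).card

/-- The invariant of the level-wise proposal algorithm.  Every `a` moves a pointer `pA a` cyclically
through its list, the best neighbour first, and `b` a pointer `pB b` with the worst one first. -/
structure LevelInv (s : ℕ) (x z : A → B → ℕ) (pA : A → ℕ) (pB : B → ℕ) : Prop where
  ptrA : ∀ a, ∃ lev, ∀ b ∈ I.prefA a,
    x a b = lev + if (I.prefA a).idxOf b < pA a then 1 else 0
  ptrB : ∀ b, ∃ lev, ∀ a ∈ I.prefB b,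
    z a b = lev + if (I.prefB b).length ≤ (I.prefB b).idxOf a + pB b then 1 else 0
  pA_lt : ∀ a, I.prefA a ≠ [] → pA a < (I.prefA a).length
  pB_lt : ∀ b, I.prefB b ≠ [] → pB b < (I.prefB b).length
  x_le : ∀ a, ∀ b ∈ I.prefA a, x a b ≤ 2 * s + 2
  card_le_up : ∀ a, (partnersA (I.held x z) a).card ≤ I.upA a
  card_le_low : ∀ a, ∀ b ∈ I.prefA a, s + 3 ≤ x a b →
    (partnersA (I.held x z) a).card ≤ I.lowA a
  low_le_card : ∀ b, ∀ a ∈ I.prefB b, 0 < z a b → I.lowB b ≤ (partnersB (I.held x z) b).card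
  up_le_card : ∀ b, ∀ a ∈ I.prefB b, s + 1 ≤ z a b → I.upB b ≤ (partnersB (I.held x z) b).card

variable {I} {s : ℕ} {x z : A → B → ℕ} {pA : A → ℕ} {pB : B → ℕ}

theorem LevelInv.init : I.LevelInv s (fun _ _ => 0) (fun _ _ => 0) (fun _ => 0) (fun _ => 0) := by
  have h : I.held (fun _ _ => 0) (fun _ _ => 0) = ∅ := by simp [held]
  refine ⟨fun a => ⟨0, by simp⟩, fun b => ⟨0, fun a ha => ?_⟩, fun a ha => List.length_pos_iff.2 ha,
    fun b hb => List.length_pos_iff.2 hb, by simp, by simp [h, partnersA], by simp, by simp,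
    by simp⟩
  have := List.idxOf_lt_length_iff.2 ha
  rw [if_neg (by omega)]

theorem LevelInv.x_pointer_le (h : I.LevelInv s x z pA pB) {a : A} {b b' : B}
    (hb : b ∈ I.prefA a) (hp : (I.prefA a).idxOf b = pA a) (hb' : b' ∈ I.prefA a) :
    x a b ≤ x a b' ∧ x a b' ≤ x a b + 1 := by
  obtain ⟨lev, hl⟩ := h.ptrA a
  rw [hl b hb, hl b' hb']
  split_ifs <;> omega

theorem LevelInv.z_pointer_le (h : I.LevelInv s x z pA pB) {b : B} {a a' : A}
    (ha : a ∈ I.prefB b) (hp : (I.prefB b).idxOf a + pB b + 1 = (I.prefB b).length)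
    (ha' : a' ∈ I.prefB b) : z a b ≤ z a' b ∧ z a' b ≤ z a b + 1 := by
  obtain ⟨lev, hl⟩ := h.ptrB b
  rw [hl a ha, hl a' ha']
  split_ifs <;> omega

/-- The pointer entry has the least level, and wanting is monotone towards lower levels. So one test
decides for the whole list. -/
theorem LevelInv.wantsA_pointer (h : I.LevelInv s x z pA pB) {a : A} {b b' : B}
    (hb : b ∈ I.prefA a) (hp : (I.prefA a).idxOf b = pA a) (hb' : b' ∈ I.prefA a)
    (hw : I.WantsA s x z a b') : I.WantsA s x z a b := by
  have := h.x_pointer_le hb hp hb'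
  unfold WantsA at *
  omega

theorem LevelInv.wantsB_pointer (h : I.LevelInv s x z pA pB) {b : B} {a a' : A}
    (ha : a ∈ I.prefB b) (hp : (I.prefB b).idxOf a + pB b + 1 = (I.prefB b).length)
    (ha' : a' ∈ I.prefB b) (hw : I.WantsB s x z b a') : I.WantsB s x z b a := by
  have := h.z_pointer_le ha hp ha'
  unfold WantsB at *
  omega

theorem WantsA.x_lt {a : A} {b : B} (hw : I.WantsA s x z a b) : x a b < 2 * s + 2 := by
  unfold WantsA at hw
  omega

/-- A vertex that wants to refuse holds some edge, whose `z` is below its `x` and hence below `2s +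
2`; the pointer entry is no higher. This bounds the refusals although `WantsB` has no level limit
above the upper quota. -/
theorem LevelInv.z_lt_of_wantsB (h : I.LevelInv s x z pA pB) {b : B} {a : A}
    (ha : a ∈ I.prefB b) (hp : (I.prefB b).idxOf a + pB b + 1 = (I.prefB b).length)
    (hw : I.WantsB s x z b a) : z a b < 2 * s + 2 := by
  have hpos : 0 < (partnersB (I.held x z) b).card := by unfold WantsB at hw; omega
  obtain ⟨a', ha'⟩ := Finset.card_pos.1 hpos
  rw [mem_partnersB, mem_held] at ha'
  have := h.z_pointer_le ha hp ((I.mem_prefA_iff a' b).1 ha'.1)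
  have := h.x_le a' b ha'.1
  omega

theorem LevelInv.advanceA (h : I.LevelInv s x z pA pB) {a : A} {b : B} (hb : b ∈ I.prefA a)
    (hp : (I.prefA a).idxOf b = pA a) (hw : I.WantsA s x z a b) :
    I.LevelInv s (bump x a b) z
      (Function.update pA a (if pA a + 1 = (I.prefA a).length then 0 else pA a + 1)) pB := by
  have hcA (a' : A) : (partnersA (I.held (bump x a b) z) a').card ≤
      (partnersA (I.held x z) a').card + if a' = a then 1 else 0 := by
    rw [held_bump_left hb]
    split_ifs with h1 <;> (try omega)
    · rw [card_partnersA_insert (by simp [mem_held, h1])]; simp [*]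
    · rw [card_partnersA_insert (by simp [mem_held, h1])]; simp [*]
  have hcB (b' : B) : (partnersB (I.held x z) b').card ≤
      (partnersB (I.held (bump x a b) z) b').card := by
    refine Finset.card_le_card (partnersB_mono ?_ _)
    rw [held_bump_left hb]
    split_ifs
    exacts [Finset.subset_insert _ _, subset_rfl]
  refine ⟨fun a' => ?_, h.ptrB, fun a' ha' => ?_, h.pB_lt, fun a' b' hb' => ?_, fun a' => ?_,
    fun a' b' hb' hx => ?_, fun b' a' ha' hz => (h.low_le_card b' a' ha' hz).trans (hcB b'),
    fun b' a' ha' hz => (h.up_le_card b' a' ha' hz).trans (hcB b')⟩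
  · by_cases ha : a' = a
    · subst ha
      obtain ⟨lev, hl⟩ := h.ptrA a'
      simp only [bump_row, Function.update_self]
      exact exists_level_of_advance hp hl
    · simpa only [bump_of_ne_left x ha, Function.update_of_ne ha] using h.ptrA a'
  · by_cases ha : a' = a
    · subst ha
      have := h.pA_lt a' ha'
      rw [Function.update_self]
      split_ifs <;> omega
    · simpa only [Function.update_of_ne ha] using h.pA_lt a' ha'
  · have h1 := h.x_le a' b' hb'
    have h2 := hw.x_lt
    simp only [bump]
    split_ifs with h3
    · rw [h3.1, h3.2]; omega
    · omega
  · have h1 := h.card_le_up a'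
    have h2 := hcA a'
    have h3 := I.lowA_le_upA a'
    by_cases ha : a' = a
    · subst ha
      unfold WantsA at hw
      simp only [if_true] at h2
      omega
    · rw [if_neg ha] at h2; omega
  -- If some edge of `a` is now at level `s + 3` or more, the pointer entry was at level at least `s
  -- + 2`. So the offer was made under the lower quota, which leaves room for one more partner.
  · have h2 := hcA a'
    by_cases ha : a' = a
    · subst ha
      have h3 := h.x_pointer_le hb hp hb'
      have h4 := h.card_le_low a' b' hb'
      rw [bump_row] at hx
      rw [if_pos rfl] at h2
      unfold WantsA at hw
      split_ifs at hx with hbb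
      · subst hbb; omega
      · omega
    · rw [bump_of_ne_left x ha] at hx
      have h1 := h.card_le_low a' b' hb' hx
      rw [if_neg ha] at h2
      omega

theorem LevelInv.advanceB (h : I.LevelInv s x z pA pB) {b : B} {a : A} (ha : a ∈ I.prefB b)
    (hp : (I.prefB b).idxOf a + pB b + 1 = (I.prefB b).length) (hw : I.WantsB s x z b a) :
    I.LevelInv s x (bump z a b) pA
      (Function.update pB b (if (I.prefB b).idxOf a = 0 then 0 else pB b + 1)) := by
  have hcB (b' : B) : (partnersB (I.held x z) b').card ≤
      (partnersB (I.held x (bump z a b)) b').card + if b' = b then 1 else 0 := by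
    rw [held_bump_right]
    split_ifs with h1 <;> (try omega)
    · rw [card_partnersB_erase (a := a) (b := b)
        (by rw [mem_held, I.mem_prefA_iff]; exact ⟨ha, by omega⟩)]
      simp [*]
    · rw [card_partnersB_erase (a := a) (b := b)
        (by rw [mem_held, I.mem_prefA_iff]; exact ⟨ha, by omega⟩)]
      simp [*]
  have hcA (a' : A) : (partnersA (I.held x (bump z a b)) a').card ≤
      (partnersA (I.held x z) a').card := by
    refine Finset.card_le_card (partnersA_mono ?_ _)
    rw [held_bump_right]
    split_ifs
    exacts [Finset.erase_subset _ _, subset_rfl]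
  refine ⟨h.ptrA, fun b' => ?_, h.pA_lt, fun b' hb' => ?_, h.x_le,
    fun a' => (hcA a').trans (h.card_le_up a'),
    fun a' b' hb' hx => (hcA a').trans (h.card_le_low a' b' hb' hx), fun b' a' ha' hz => ?_,
    fun b' a' ha' hz => ?_⟩
  · by_cases hb : b' = b
    · subst hb
      obtain ⟨lev, hl⟩ := h.ptrB b'
      simp only [bump_col, Function.update_self]
      exact exists_level_of_advance_reverse hp hl
    · simpa only [bump_of_ne_right z _ _ hb, Function.update_of_ne hb] using h.ptrB b'
  · by_cases hb : b' = b
    · subst hb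
      have := h.pB_lt b' hb'
      rw [Function.update_self]
      split_ifs <;> omega
    · simpa only [Function.update_of_ne hb] using h.pB_lt b' hb'
  · have h2 := hcB b'
    by_cases hb : b' = b
    · subst hb
      have h3 := I.lowB_le_upB b'
      unfold WantsB at hw
      rw [if_pos rfl] at h2
      omega
    · rw [bump_of_ne_right z _ _ hb] at hz
      have h1 := h.low_le_card b' a' ha' hz
      rw [if_neg hb] at h2
      omega
  -- If some edge of `b` has now been refused up to `s + 1`, the pointer entry was at level at least
  -- `s`. So the refusal was made above the upper quota, and losing one partner is harmless.
  · have h2 := hcB b'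
    by_cases hb : b' = b
    · subst hb
      have h3 := h.z_pointer_le ha hp ha'
      have h4 := h.up_le_card b' a' ha'
      rw [bump_col] at hz
      rw [if_pos rfl] at h2
      unfold WantsB at hw
      split_ifs at hz with haa
      · subst haa; omega
      · omega
    · rw [bump_of_ne_right z _ _ hb] at hz
      have h1 := h.up_le_card b' a' ha' hz
      rw [if_neg hb] at h2
      omega

/-- The conditions on shortage at `A` and excess at `B` say that nobody wants to move. The
conditions on excess at `A` and shortage at `B` are the history recorded by the cardinality fields
of `LevelInv`. -/
theorem LevelInv.levelCertificate (h : I.LevelInv s x z pA pB)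
    (hA : ∀ a, ∀ b ∈ I.prefA a, ¬ I.WantsA s x z a b)
    (hB : ∀ b, ∀ a ∈ I.prefB b, ¬ I.WantsB s x z b a) :
    LevelCertificate I (I.held x z) s x z where
  isMatching := by
    refine ⟨Finset.filter_subset _ _, h.card_le_up, fun b => ?_⟩
    by_contra! hlt
    obtain ⟨a, ha⟩ := Finset.card_pos.1 (Nat.zero_lt_of_lt hlt)
    rw [mem_partnersB, mem_held, I.mem_prefA_iff] at ha
    exact hB b a ha.1 (Or.inr hlt)
  lt_of_mem a b hab := (mem_held.1 hab).2
  le_of_notMem a b hb hab := by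
    rw [mem_held] at hab
    exact not_lt.1 fun hlt => hab ⟨hb, hlt⟩
  x_le := h.x_le
  x_mono a b hb b' hb' hlt := by
    obtain ⟨lev, hl⟩ := h.ptrA a
    rw [hl b hb, hl b' hb']
    split_ifs <;> omega
  z_mono b a ha a' ha' hlt := by
    obtain ⟨lev, hl⟩ := h.ptrB b
    rw [hl a ha, hl a' ha']
    split_ifs <;> omega
  x_of_lt_up a hlt b hb := by
    have := hA a b hb
    unfold WantsA at this
    omega
  x_of_lt_low a hlt b hb := by
    have := hA a b hb
    have := h.x_le a b hb
    unfold WantsA at *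
    omega
  z_of_low_lt a hlt b hb := by
    rw [mem_held] at hb
    have := h.card_le_low a b hb.1
    omega
  z_of_lt_up b hlt a ha := by
    have := h.up_le_card b a ha
    omega
  z_of_lt_low b hlt a ha := by
    have := h.low_le_card b a ha
    omega
  z_of_low_lt' b hlt a ha := by
    rw [mem_held, I.mem_prefA_iff] at ha
    have := hB b a ha.1
    unfold WantsB at this
    omega

end QuotaInstance

end ManyToMany

namespace ManyToMany

open Finset

/-! ### Loop-free programs and a loop rule -/

theorem Test.eval_lt (s : State) (e f : Expr) :
    (Test.lt e f).eval s = true ↔ e.eval s < f.eval s := decide_eq_true_iff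

theorem Test.eval_eq (s : State) (e f : Expr) :
    (Test.eq e f).eval s = true ↔ e.eval s = f.eval s := decide_eq_true_iff

theorem Test.eval_not (s : State) (t : Test) :
    (Test.not t).eval s = true ↔ ¬ t.eval s = true := by simp [Test.eval]

theorem Test.eval_and (s : State) (t u : Test) :
    (Test.and t u).eval s = true ↔ t.eval s = true ∧ u.eval s = true := by simp [Test.eval]

namespace Program

def LoopFree : Program → Prop
  | skip => True
  | assign _ _ => True
  | store _ _ _ => True
  | seq p q => p.LoopFree ∧ q.LoopFree
  | branch _ p q => p.LoopFree ∧ q.LoopFree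
  | loop _ _ => False

/-- The final state of a loop-free program. -/
def run : Program → State → State
  | skip, s => s
  | assign x e, s => s.setReg x (e.eval s)
  | store k i e, s => s.setArr k (i.eval s) (e.eval s)
  | seq p q, s => q.run (p.run s)
  | branch t p q, s => if t.eval s = true then p.run s else q.run s
  | loop _ _, s => s

/-- An upper bound on the running time of a loop-free program. -/
def stepBound : Program → ℕ
  | skip => 1
  | assign _ e => e.cost + 1
  | store _ i e => i.cost + e.cost + 1
  | seq p q => p.stepBound + q.stepBound
  | branch t p q => t.cost + (p.stepBound + q.stepBound) + 1
  | loop _ _ => 0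

theorem LoopFree.exec_run {p : Program} (h : p.LoopFree) (s : State) :
    ∃ n ≤ p.stepBound, Exec p s (p.run s) n := by
  induction p generalizing s with
  | skip => exact ⟨1, le_rfl, .skip s⟩
  | assign x e => exact ⟨_, le_rfl, .assign x e s⟩
  | store k i e => exact ⟨_, le_rfl, .store k i e s⟩
  | seq p q ihp ihq =>
    obtain ⟨m, hm, hp⟩ := ihp h.1 s
    obtain ⟨n, hn, hq⟩ := ihq h.2 (p.run s)
    exact ⟨m + n, Nat.add_le_add hm hn, .seq hp hq⟩
  | branch t p q ihp ihq =>
    obtain ⟨m, hm, hp⟩ := ihp h.1 s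
    obtain ⟨n, hn, hq⟩ := ihq h.2 s
    by_cases ht : t.eval s = true
    · refine ⟨t.cost + m + 1, by simp only [stepBound]; omega, ?_⟩
      simpa only [run, if_pos ht] using Exec.branchTrue ht hp
    · refine ⟨t.cost + n + 1, by simp only [stepBound]; omega, ?_⟩
      simpa only [run, if_neg ht] using Exec.branchFalse (Bool.not_eq_true _ ▸ ht) hq
  | loop => exact h.elim

end Program

/-- There are at most `Φ s` rounds; the additional summand 1 pays for the final failing test. -/
theorem exec_loop_of_potential {t : Test} {p : Program} (hp : p.LoopFree) (Inv : State → Prop)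
    (Φ : State → ℕ)
    (step : ∀ s, Inv s → t.eval s = true → Inv (p.run s) ∧ Φ (p.run s) < Φ s) (s : State)
    (hs : Inv s) :
    ∃ s' n, Exec (.loop t p) s s' n ∧ Inv s' ∧ t.eval s' = false ∧
      n ≤ (Φ s + 1) * (p.stepBound + t.cost + 1) := by
  induction hN : Φ s using Nat.strong_induction_on generalizing s with
  | _ N ih =>
    by_cases ht : t.eval s = true
    · obtain ⟨h1, h2⟩ := step s hs ht
      obtain ⟨m, hm, he⟩ := hp.exec_run s
      obtain ⟨s', n, he', hs', ht', hn⟩ := ih _ (hN ▸ h2) _ h1 rfl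
      refine ⟨s', _, .loopTrue ht he he', hs', ht', ?_⟩
      have h3 : Φ (p.run s) + 1 ≤ N := hN ▸ h2
      have h4 := Nat.mul_le_mul_right (p.stepBound + t.cost + 1) h3
      rw [Nat.add_mul N 1]
      omega
    · have hf : t.eval s = false := by simpa using ht
      refine ⟨s, _, .loopFalse hf, hs, hf, ?_⟩
      rw [Nat.add_mul]
      have := Nat.zero_le (N * (p.stepBound + t.cost + 1))
      omega

/-! ### The layout of concatenated lists -/

section Layout

variable {n m : ℕ}

def valLists (p : Fin n → List (Fin m)) : List (List ℕ) :=
  List.ofFn fun i => (p i).map Fin.val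

theorem startOf_zero (L : List (List ℕ)) : startOf L 0 = 0 := by simp [startOf]

theorem startOf_succ (p : Fin n → List (Fin m)) (i : Fin n) :
    startOf (valLists p) (i + 1) = startOf (valLists p) i + (p i).length := by
  have h : (i : ℕ) < (valLists p).length := by simp [valLists]
  simp only [startOf, List.map_take]
  rw [List.sum_take_succ _ _ (by simpa using h)]
  simp [valLists]

theorem startOf_mono (L : List (List ℕ)) {i j : ℕ} (h : i ≤ j) : startOf L i ≤ startOf L j := by
  simp only [startOf]
  exact List.Sublist.sum_le_sum ((List.take_sublist_take_left h).map _) (fun _ _ => Nat.zero_le _)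

theorem startOf_last (p : Fin n → List (Fin m)) :
    startOf (valLists p) n = ∑ i, (p i).length := by
  rw [startOf, List.take_of_length_le (by simp [valLists]), valLists, List.map_ofFn, List.sum_ofFn]
  simp

theorem startOf_add_lt (p : Fin n → List (Fin m)) (i : Fin n) {k : ℕ} (hk : k < (p i).length) :
    startOf (valLists p) i + k < startOf (valLists p) n := by
  have h1 := startOf_succ p i
  have h2 := startOf_mono (valLists p) (Nat.succ_le_of_lt i.2)
  simp only [Nat.succ_eq_add_one] at h2
  omega

/-- Different lists occupy disjoint intervals of the concatenation, so a position identifies both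
the list and the index in it. -/
theorem startOf_add_inj (p : Fin n → List (Fin m)) {i j : Fin n} {k l : ℕ}
    (hk : k < (p i).length) (hl : l < (p j).length)
    (h : startOf (valLists p) i + k = startOf (valLists p) j + l) : i = j ∧ k = l := by
  have hij : i = j := by
    by_contra hne
    rcases lt_or_gt_of_ne hne with hlt | hlt
    · have h1 := startOf_succ p i
      have h2 := startOf_mono (valLists p) (Nat.succ_le_of_lt hlt)
      simp only [Nat.succ_eq_add_one] at h2
      omega
    · have h1 := startOf_succ p j
      have h2 := startOf_mono (valLists p) (Nat.succ_le_of_lt hlt)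
      simp only [Nat.succ_eq_add_one] at h2
      omega
  subst hij
  exact ⟨rfl, by omega⟩

theorem flatten_getElem?_startOf (L : List (List ℕ)) (i k : ℕ) (hi : i < L.length)
    (hk : k < L[i].length) : L.flatten[startOf L i + k]? = some L[i][k] := by
  induction L generalizing i with
  | nil => simp at hi
  | cons l L ih =>
    cases i with
    | zero =>
      simp only [startOf_zero, Nat.zero_add, List.flatten_cons, List.getElem_cons_zero] at hk ⊢
      rw [List.getElem?_append_left hk, List.getElem?_eq_getElem hk]
    | succ i =>
      have h1 : startOf (l :: L) (i + 1) = l.length + startOf L i := by simp [startOf]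
      simp only [List.getElem_cons_succ, List.length_cons, Nat.add_lt_add_iff_right] at hk hi ⊢
      rw [h1, List.flatten_cons, List.getElem?_append_right (by omega), ← ih i hi hk]
      congr 1
      omega

theorem arrayOf_flatten (p : Fin n → List (Fin m)) (i : Fin n) {k : ℕ} (hk : k < (p i).length) :
    arrayOf (valLists p).flatten (startOf (valLists p) i + k) = (p i)[k] := by
  have h1 : (i : ℕ) < (valLists p).length := by simp [valLists]
  have h2 : (valLists p)[(i : ℕ)] = (p i).map Fin.val := by simp [valLists]
  have h := flatten_getElem?_startOf (valLists p) i k h1 (by simpa [h2] using hk)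
  rw [arrayOf, List.getD_eq_getElem?_getD, h]
  simp [h2]

theorem arrayOf_flatten_idxOf (p : Fin n → List (Fin m)) {i : Fin n} {j : Fin m} (hj : j ∈ p i) :
    arrayOf (valLists p).flatten (startOf (valLists p) i + (p i).idxOf j) = j := by
  rw [arrayOf_flatten p i (List.idxOf_lt_length_iff.2 hj)]
  simp

theorem arrayOf_ofFn (f : Fin n → ℕ) (i : Fin n) : arrayOf (List.ofFn f) i = f i := by
  simp [arrayOf]

theorem update_val (f : ℕ → ℕ) (i : Fin n) (v : ℕ) :
    (fun j : Fin n => Function.update f i v j) = Function.update (fun j : Fin n => f j) i v := by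
  ext j
  simp only [Function.update_apply, Fin.ext_iff]

end Layout

/-! ### Addresses of edges in the arrays. -/

namespace QuotaInstance

variable {nA nB : ℕ} (I : QuotaInstance (Fin nA) (Fin nB))

theorem listsA_eq : I.listsA = valLists I.prefA := rfl

theorem listsB_eq : I.listsB = valLists I.prefB := rfl

theorem startOf_listsA_last : startOf I.listsA nA = I.edges.card := by
  rw [listsA_eq, startOf_last, ← sum_card_partnersA]
  refine Finset.sum_congr rfl fun a _ => ?_
  rw [← List.toFinset_card_of_nodup (I.prefA_nodup a)]
  congr 1
  ext b
  simp [mem_partnersA, mem_edges]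

theorem startOf_listsB_last : startOf I.listsB nB = I.edges.card := by
  rw [listsB_eq, startOf_last, ← sum_card_partnersB]
  refine Finset.sum_congr rfl fun b _ => ?_
  rw [← List.toFinset_card_of_nodup (I.prefB_nodup b)]
  congr 1
  ext a
  simp [mem_partnersB, mem_edges, mem_prefA_iff]

/-- The position of the edge `(a, b)` in the list of `a`. -/
def posA (a : Fin nA) (b : Fin nB) : ℕ :=
  startOf I.listsA a + (I.prefA a).idxOf b

/-- The position of the edge `(a, b)` in the list of `b`. -/
def posB (a : Fin nA) (b : Fin nB) : ℕ :=
  startOf I.listsB b + (I.prefB b).idxOf a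

variable {I}

theorem posA_inj {a a' : Fin nA} {b b' : Fin nB} (h : b ∈ I.prefA a) (h' : b' ∈ I.prefA a') :
    I.posA a b = I.posA a' b' ↔ a = a' ∧ b = b' := by
  refine ⟨fun e => ?_, by rintro ⟨rfl, rfl⟩; rfl⟩
  obtain ⟨rfl, h2⟩ := startOf_add_inj I.prefA (List.idxOf_lt_length_iff.2 h)
    (List.idxOf_lt_length_iff.2 h') e
  exact ⟨rfl, (List.idxOf_inj h).1 h2⟩

theorem posB_inj {a a' : Fin nA} {b b' : Fin nB} (h : a ∈ I.prefB b) (h' : a' ∈ I.prefB b') :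
    I.posB a b = I.posB a' b' ↔ a = a' ∧ b = b' := by
  refine ⟨fun e => ?_, by rintro ⟨rfl, rfl⟩; rfl⟩
  obtain ⟨rfl, h2⟩ := startOf_add_inj I.prefB (List.idxOf_lt_length_iff.2 h)
    (List.idxOf_lt_length_iff.2 h') e
  exact ⟨(List.idxOf_inj h).1 h2, rfl⟩

theorem posA_lt {a : Fin nA} {b : Fin nB} (h : b ∈ I.prefA a) : I.posA a b < I.edges.card := by
  rw [← startOf_listsA_last]
  exact startOf_add_lt I.prefA a (List.idxOf_lt_length_iff.2 h)

variable (I) in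
/-- The function on the edges that is stored in the array `f`, indexed by `posA`. -/
def readEdges (f : ℕ → ℕ) : Fin nA → Fin nB → ℕ :=
  fun a b => if b ∈ I.prefA a then f (I.posA a b) else 0

theorem readEdges_apply (f : ℕ → ℕ) {a : Fin nA} {b : Fin nB} (h : b ∈ I.prefA a) :
    I.readEdges f a b = f (I.posA a b) := by
  simp [readEdges, h]

theorem readEdges_update (f : ℕ → ℕ) {a : Fin nA} {b : Fin nB} (h : b ∈ I.prefA a) :
    I.readEdges (Function.update f (I.posA a b) (f (I.posA a b) + 1)) =
      bump (I.readEdges f) a b := by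
  ext a' b'
  by_cases h' : b' ∈ I.prefA a'
  · simp only [readEdges, bump, if_pos h', Function.update_apply, posA_inj h' h]
    split_ifs with h1
    · rw [h1.1, h1.2]
    · rfl
  · have : ¬ (a' = a ∧ b' = b) := by rintro ⟨rfl, rfl⟩; exact h' h
    simp [readEdges, bump, h', this]

end QuotaInstance

end ManyToMany

namespace ManyToMany

open Finset

/-! ### Counters, output marks and the stack under a single move. -/

namespace QuotaInstance

variable {nA nB : ℕ}

/-- The invariant of the main loop: `stack` holds, below `sp`, all vertices of `A` that may want to
make an offer, and only `cur` among the vertices of `B` may want to refuse one. -/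
structure RunInv (I : QuotaInstance (Fin nA) (Fin nB)) (s : ℕ) (x z : Fin nA → Fin nB → ℕ)
    (pA : Fin nA → ℕ) (pB : Fin nB → ℕ) (cntA cntB out stack : ℕ → ℕ) (sp cur : ℕ) : Prop where
  level : I.LevelInv s x z pA pB
  cntA_eq : ∀ a : Fin nA, cntA a = (partnersA (I.held x z) a).card
  cntB_eq : ∀ b : Fin nB, cntB b = (partnersB (I.held x z) b).card
  out_eq : ∀ a, ∀ b ∈ I.prefA a, out (I.posA a b) = 1 ↔ (a, b) ∈ I.held x z
  cur_lt : 0 < nB → cur < nB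
  stack_valid : ∀ i < sp, ∃ a : Fin nA, I.prefA a ≠ [] ∧ stack i = a
  wantsA_mem : ∀ a, ∀ b ∈ I.prefA a, I.WantsA s x z a b → ∃ i < sp, stack i = a
  wantsB_cur : ∀ b, ∀ a ∈ I.prefB b, I.WantsB s x z b a → cur = b
  empty : sp = 0 → ∀ b, ∀ a ∈ I.prefB b, ¬ I.WantsB s x z b a

variable {I : QuotaInstance (Fin nA) (Fin nB)} {s : ℕ} {x z : Fin nA → Fin nB → ℕ}
  {pA : Fin nA → ℕ} {pB : Fin nB → ℕ} {cntA cntB out stack : ℕ → ℕ} {sp cur : ℕ}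

/-- The held set does not change here, so only the pointer and the level of `b` move. Positivity of
`sp` keeps the field `empty` vacuous, since `b` may still want to refuse. -/
theorem RunInv.refuse_again (h : I.RunInv s x z pA pB cntA cntB out stack sp cur) (hsp : 0 < sp)
    {a : Fin nA} {b : Fin nB} (ha : a ∈ I.prefB b)
    (hp : (I.prefB b).idxOf a + pB b + 1 = (I.prefB b).length) (hw : I.WantsB s x z b a)
    (hxz : x a b ≠ z a b + 1) :
    I.RunInv s x (bump z a b) pA
      (Function.update pB b (if (I.prefB b).idxOf a = 0 then 0 else pB b + 1))
      cntA cntB out stack sp cur := by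
  have hheld : I.held x (bump z a b) = I.held x z := by rw [held_bump_right, if_neg hxz]
  refine ⟨h.level.advanceB ha hp hw, ?_, ?_, ?_, h.cur_lt, h.stack_valid, ?_, ?_, ?_⟩
  · simpa only [hheld] using h.cntA_eq
  · simpa only [hheld] using h.cntB_eq
  · simpa only [hheld] using h.out_eq
  · simpa only [WantsA, hheld] using h.wantsA_mem
  · intro b' a' ha' hw'
    by_cases hb : b' = b
    · subst hb; exact h.wantsB_cur b' a ha hw
    · refine h.wantsB_cur b' a' ha' ?_
      simpa only [WantsB, hheld, bump_of_ne_right z _ _ hb] using hw'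
  · intro h0; omega

/-- The held edge is dropped, so `a` is the only vertex that may newly want to make an offer, and it
is pushed on the stack. -/
theorem RunInv.refuse_first (h : I.RunInv s x z pA pB cntA cntB out stack sp cur)
    {a : Fin nA} {b : Fin nB} (ha : a ∈ I.prefB b)
    (hp : (I.prefB b).idxOf a + pB b + 1 = (I.prefB b).length) (hw : I.WantsB s x z b a)
    (hxz : x a b = z a b + 1) :
    I.RunInv s x (bump z a b) pA
      (Function.update pB b (if (I.prefB b).idxOf a = 0 then 0 else pB b + 1))
      (Function.update cntA a (cntA a - 1)) (Function.update cntB b (cntB b - 1))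
      (Function.update out (I.posA a b) 0) (Function.update stack sp a) (sp + 1) cur := by
  have hba : b ∈ I.prefA a := (I.mem_prefA_iff a b).2 ha
  have hheld : I.held x (bump z a b) = (I.held x z).erase (a, b) := by
    rw [held_bump_right, if_pos hxz]
  have hmem : (a, b) ∈ I.held x z := mem_held.2 ⟨hba, by omega⟩
  have hA := card_partnersA_erase hmem
  have hB := card_partnersB_erase hmem
  refine ⟨h.level.advanceB ha hp hw, fun a' => ?_, fun b' => ?_, fun a' b' hb' => ?_, h.cur_lt,
    fun i hi => ?_, fun a' b' hb' hw' => ?_, fun b' a' ha' hw' => ?_, fun h0 => by omega⟩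
  · rw [hheld, Function.update_apply]
    have := hA a'
    have h1 := h.cntA_eq a'
    simp only [← Fin.ext_iff]
    split_ifs with haa
    · subst haa; simp at this; omega
    · simp [haa] at this; omega
  · rw [hheld, Function.update_apply]
    have := hB b'
    have h1 := h.cntB_eq b'
    simp only [← Fin.ext_iff]
    split_ifs with hbb
    · subst hbb; simp at this; omega
    · simp [hbb] at this; omega
  · rw [hheld, Function.update_apply]
    simp only [posA_inj hb' hba]
    have := h.out_eq a' b' hb'
    split_ifs with he
    · simp [he]
    · rw [this, Finset.mem_erase]
      simp [he]
  · rw [Function.update_apply]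
    split_ifs with hi'
    · exact ⟨a, List.ne_nil_of_mem hba, rfl⟩
    · exact h.stack_valid i (by omega)
  · by_cases haa : a' = a
    · exact ⟨sp, by omega, by simp [haa]⟩
    · have h1 := hA a'
      rw [if_neg haa, add_zero, ← hheld] at h1
      obtain ⟨i, hi, hi'⟩ := h.wantsA_mem a' b' hb' (by simpa only [WantsA, h1] using hw')
      exact ⟨i, by omega, by rw [Function.update_of_ne (by omega), hi']⟩
  · by_cases hb : b' = b
    · subst hb; exact h.wantsB_cur b' a ha hw
    · have h1 := hB b'
      rw [if_neg hb, add_zero, ← hheld] at h1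
      refine h.wantsB_cur b' a' ha' ?_
      simpa only [WantsB, h1, bump_of_ne_right z _ _ hb] using hw'

theorem RunInv.offer_again (h : I.RunInv s x z pA pB cntA cntB out stack sp cur) (hsp : 0 < sp)
    {a : Fin nA} {b : Fin nB} (hb : b ∈ I.prefA a) (hp : (I.prefA a).idxOf b = pA a)
    (htop : stack (sp - 1) = a) (hw : I.WantsA s x z a b) (hxz : x a b ≠ z a b) :
    I.RunInv s (bump x a b) z
      (Function.update pA a (if pA a + 1 = (I.prefA a).length then 0 else pA a + 1)) pB
      cntA cntB out stack sp cur := by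
  have hheld : I.held (bump x a b) z = I.held x z := by rw [held_bump_left hb, if_neg hxz]
  refine ⟨h.level.advanceA hb hp hw, ?_, ?_, ?_, h.cur_lt, h.stack_valid, ?_, ?_, ?_⟩
  · simpa only [hheld] using h.cntA_eq
  · simpa only [hheld] using h.cntB_eq
  · simpa only [hheld] using h.out_eq
  · intro a' b' hb' hw'
    by_cases haa : a' = a
    · exact ⟨sp - 1, by omega, by rw [htop, haa]⟩
    · refine h.wantsA_mem a' b' hb' ?_
      simpa only [WantsA, hheld, bump_of_ne_left x haa] using hw'
  · simpa only [WantsB, hheld] using h.wantsB_cur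
  · simpa only [WantsB, hheld] using h.empty

/-- Nobody on the `B`-side wanted to refuse, and only `b` gains an edge; so `b` is the only
candidate for refusing and becomes `cur`. The vertex `a` stays on top of the stack. -/
theorem RunInv.offer_first (h : I.RunInv s x z pA pB cntA cntB out stack sp cur) (hsp : 0 < sp)
    {a : Fin nA} {b : Fin nB} (hb : b ∈ I.prefA a) (hp : (I.prefA a).idxOf b = pA a)
    (htop : stack (sp - 1) = a) (hw : I.WantsA s x z a b)
    (hB : ∀ b, ∀ a ∈ I.prefB b, ¬ I.WantsB s x z b a) (hxz : x a b = z a b) :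
    I.RunInv s (bump x a b) z
      (Function.update pA a (if pA a + 1 = (I.prefA a).length then 0 else pA a + 1)) pB
      (Function.update cntA a (cntA a + 1)) (Function.update cntB b (cntB b + 1))
      (Function.update out (I.posA a b) 1) stack sp b := by
  have hheld : I.held (bump x a b) z = insert (a, b) (I.held x z) := by
    rw [held_bump_left hb, if_pos hxz]
  have hmem : (a, b) ∉ I.held x z := fun h' => by rw [mem_held] at h'; omega
  have hcA := card_partnersA_insert hmem
  have hcB := card_partnersB_insert hmem
  rw [← hheld] at hcA hcB
  refine ⟨h.level.advanceA hb hp hw, fun a' => ?_, fun b' => ?_, fun a' b' hb' => ?_,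
    fun _ => b.2, h.stack_valid, fun a' b' hb' hw' => ?_, fun b' a' ha' hw' => ?_,
    fun h0 => by omega⟩
  · rw [Function.update_apply, hcA a', h.cntA_eq, h.cntA_eq]
    simp only [← Fin.ext_iff]
    split_ifs with haa
    · rw [haa]
    · rfl
  · rw [Function.update_apply, hcB b', h.cntB_eq, h.cntB_eq]
    simp only [← Fin.ext_iff]
    split_ifs with hbb
    · rw [hbb]
    · rfl
  · rw [hheld, Function.update_apply]
    simp only [posA_inj hb' hb]
    have := h.out_eq a' b' hb'
    split_ifs with he
    · simp [he]
    · rw [this, Finset.mem_insert]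
      simp [he]
  · by_cases haa : a' = a
    · exact ⟨sp - 1, by omega, by rw [htop, haa]⟩
    · have h1 := hcA a'
      rw [if_neg haa, add_zero] at h1
      refine h.wantsA_mem a' b' hb' ?_
      simpa only [WantsA, h1, bump_of_ne_left x haa] using hw'
  · by_contra hne
    have h1 := hcB b'
    rw [if_neg (fun e => hne (by rw [e])), add_zero] at h1
    exact hB b' a' ha' (by simpa only [WantsB, h1] using hw')

/-- Vertices are removed only while no refusal is pending. Hence an empty stack, the sole exit
condition of the loop, means that both sides are at rest. -/
theorem RunInv.pop (h : I.RunInv s x z pA pB cntA cntB out stack sp cur)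
    {a : Fin nA} (htop : stack (sp - 1) = a) (hw : ∀ b ∈ I.prefA a, ¬ I.WantsA s x z a b)
    (hB : ∀ b, ∀ a ∈ I.prefB b, ¬ I.WantsB s x z b a) :
    I.RunInv s x z pA pB cntA cntB out stack (sp - 1) cur := by
  refine ⟨h.level, h.cntA_eq, h.cntB_eq, h.out_eq, h.cur_lt,
    fun i hi => h.stack_valid i (by omega), fun a' b' hb' hw' => ?_, h.wantsB_cur, fun _ => hB⟩
  obtain ⟨i, hi, hi'⟩ := h.wantsA_mem a' b' hb' hw'
  refine ⟨i, ?_, hi'⟩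
  by_contra hlt
  have : i = sp - 1 := by omega
  subst this
  have : a = a' := Fin.ext (htop.symm.trans hi')
  subst this
  exact hw b' hb' hw'

theorem RunInv.init (hstack : ∀ i < sp, ∃ a : Fin nA, I.prefA a ≠ [] ∧ stack i = a)
    (hmem : ∀ a, I.prefA a ≠ [] → ∃ i < sp, stack i = a) :
    I.RunInv s (fun _ _ => 0) (fun _ _ => 0) (fun _ => 0) (fun _ => 0) (fun _ => 0) (fun _ => 0)
      (fun _ => 0) stack sp 0 := by
  have h : I.held (fun _ _ => 0) (fun _ _ => 0) = ∅ := by simp [held]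
  exact ⟨LevelInv.init, by simp [h, partnersA], by simp [h, partnersB], by simp [h], id, hstack,
    fun a b hb _ => hmem a (List.ne_nil_of_mem hb), by simp [WantsB, h, partnersB],
    by simp [WantsB, h, partnersB]⟩

end QuotaInstance

end ManyToMany

namespace ManyToMany

open Finset

/-! ### The main loop

Register 2 holds the number of edges, register 3 the current vertex of `B`, and register 6 the
height of the stack; registers 4, 5 and 7 are temporary.  Array 8 marks the held edges, array 9
maps positions in the lists of `B` to positions in the lists of `A`, arrays 10 and 11 count offers
and refusals of each edge, arrays 12 and 13 hold the pointers and arrays 14 and 15 the numbers of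
partners of the vertices of `A` and `B`, and array 16 is the stack. -/

/-- The current vertex of `B` wants to refuse the edge in register 5. -/
def testB : Test :=
  .not (.and
    (.not (.and (.lt (.get 2 (.reg 3)) (.get 15 (.reg 3)))
      (.lt (.get 11 (.reg 5)) (.add (.reg 2) (.const 1)))))
    (.not (.lt (.get 3 (.reg 3)) (.get 15 (.reg 3)))))

/-- The vertex of `A` in register 7 wants to offer the edge in register 5. -/
def testA : Test :=
  .not (.and
    (.not (.and (.lt (.get 14 (.reg 7)) (.get 1 (.reg 7)))
      (.lt (.get 10 (.reg 5)) (.add (.reg 2) (.const 3)))))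
    (.not (.and (.lt (.get 14 (.reg 7)) (.get 0 (.reg 7)))
      (.lt (.get 10 (.reg 5)) (.add (.add (.reg 2) (.reg 2)) (.const 4))))))

def refuseMark : Program :=
  .branch (.eq (.get 10 (.reg 5)) (.add (.get 11 (.reg 5)) (.const 1)))
    (.seq (.store 8 (.reg 5) (.const 0))
    (.seq (.assign 7 (.get 7 (.reg 4)))
    (.seq (.store 14 (.reg 7) (.sub (.get 14 (.reg 7)) (.const 1)))
    (.seq (.store 15 (.reg 3) (.sub (.get 15 (.reg 3)) (.const 1)))
    (.seq (.store 16 (.reg 6) (.reg 7))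
      (.assign 6 (.add (.reg 6) (.const 1))))))))
    .skip

def refuseMove : Program :=
  .seq (.store 11 (.reg 5) (.add (.get 11 (.reg 5)) (.const 1)))
    (.branch (.eq (.get 6 (.reg 3)) (.reg 4))
      (.store 13 (.reg 3) (.const 0))
      (.store 13 (.reg 3) (.add (.get 13 (.reg 3)) (.const 1))))

def offerMark : Program :=
  .branch (.eq (.get 10 (.reg 5)) (.get 11 (.reg 5)))
    (.seq (.store 8 (.reg 5) (.const 1))
    (.seq (.store 14 (.reg 7) (.add (.get 14 (.reg 7)) (.const 1)))
    (.seq (.assign 3 (.get 5 (.reg 5)))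
      (.store 15 (.reg 3) (.add (.get 15 (.reg 3)) (.const 1))))))
    .skip

def offerMove : Program :=
  .seq (.store 10 (.reg 5) (.add (.get 10 (.reg 5)) (.const 1)))
    (.branch (.eq (.add (.reg 5) (.const 1)) (.get 4 (.add (.reg 7) (.const 1))))
      (.store 12 (.reg 7) (.const 0))
      (.store 12 (.reg 7) (.add (.get 12 (.reg 7)) (.const 1))))

def mainBody : Program :=
  .seq (.assign 4 (.sub (.get 6 (.add (.reg 3) (.const 1)))
    (.add (.get 13 (.reg 3)) (.const 1))))
  (.seq (.assign 5 (.get 9 (.reg 4)))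
  (.branch testB (.seq refuseMark refuseMove)
    (.seq (.assign 7 (.get 16 (.sub (.reg 6) (.const 1))))
    (.seq (.assign 5 (.add (.get 4 (.reg 7)) (.get 12 (.reg 7))))
    (.branch testA (.seq offerMark offerMove)
      (.assign 6 (.sub (.reg 6) (.const 1))))))))

def mainTest : Test := .lt (.const 0) (.reg 6)

theorem mainBody_loopFree : mainBody.LoopFree := by
  simp [mainBody, refuseMark, refuseMove, offerMark, offerMove, Program.LoopFree]

variable {nA nB : ℕ}

structure MainInv (I : QuotaInstance (Fin nA) (Fin nB)) (s : State) : Prop where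
  frame : ∀ k < 8, s.arr k = I.encode.arr k
  size : s.reg 2 = I.edges.card
  cross : ∀ a, ∀ b ∈ I.prefA a, s.arr 9 (I.posB a b) = I.posA a b
  run : I.RunInv (I.edges.card + 1) (I.readEdges (s.arr 10)) (I.readEdges (s.arr 11))
    (fun a => s.arr 12 a) (fun b => s.arr 13 b) (s.arr 14) (s.arr 15) (s.arr 8) (s.arr 16)
    (s.reg 6) (s.reg 3)

/-- Refusals have weight 2 because a refusal may push a vertex on the stack, which raises the last
term by one. -/
def mainPotential (I : QuotaInstance (Fin nA) (Fin nB)) (s : State) : ℕ :=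
  ∑ e ∈ I.edges, (2 * (I.edges.card + 1) + 2 - I.readEdges (s.arr 10) e.1 e.2) +
    2 * ∑ e ∈ I.edges, (2 * (I.edges.card + 1) + 2 - I.readEdges (s.arr 11) e.1 e.2) + s.reg 6

variable {I : QuotaInstance (Fin nA) (Fin nB)} {s : State}

section Frame

variable (h : ∀ k < 8, s.arr k = I.encode.arr k)

include h

theorem frame_lowA (a : Fin nA) : s.arr 0 a = I.lowA a := by
  rw [h 0 (by norm_num)]; exact arrayOf_ofFn _ a

theorem frame_upA (a : Fin nA) : s.arr 1 a = I.upA a := by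
  rw [h 1 (by norm_num)]; exact arrayOf_ofFn _ a

theorem frame_lowB (b : Fin nB) : s.arr 2 b = I.lowB b := by
  rw [h 2 (by norm_num)]; exact arrayOf_ofFn _ b

theorem frame_upB (b : Fin nB) : s.arr 3 b = I.upB b := by
  rw [h 3 (by norm_num)]; exact arrayOf_ofFn _ b

theorem frame_startA (i : ℕ) : s.arr 4 i = startOf I.listsA i := by
  rw [h 4 (by norm_num)]; rfl

theorem frame_startB (i : ℕ) : s.arr 6 i = startOf I.listsB i := by
  rw [h 6 (by norm_num)]; rfl

theorem frame_posA {a : Fin nA} {b : Fin nB} (hb : b ∈ I.prefA a) : s.arr 5 (I.posA a b) = b := by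
  rw [h 5 (by norm_num)]; exact arrayOf_flatten_idxOf I.prefA hb

theorem frame_posB {a : Fin nA} {b : Fin nB} (ha : a ∈ I.prefB b) : s.arr 7 (I.posB a b) = a := by
  rw [h 7 (by norm_num)]; exact arrayOf_flatten_idxOf I.prefB ha

end Frame

theorem MainInv.setReg (h : MainInv I s) {k v : ℕ} (h2 : k ≠ 2) (h3 : k ≠ 3) (h6 : k ≠ 6) :
    MainInv I (s.setReg k v) := by
  refine ⟨h.frame, ?_, h.cross, ?_⟩
  · simpa [State.setReg, Function.update_of_ne h2.symm] using h.size
  · simpa [State.setReg, Function.update_of_ne h3.symm, Function.update_of_ne h6.symm] using h.run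

theorem mainPotential_setReg {k v : ℕ} (h6 : k ≠ 6) :
    mainPotential I (s.setReg k v) = mainPotential I s := by
  simp [mainPotential, State.setReg, Function.update_of_ne h6.symm]

theorem MainInv.refuse (h : MainInv I s) (hsp : 0 < s.reg 6) {a : Fin nA} {b : Fin nB}
    (ha : a ∈ I.prefB b) (h3 : s.reg 3 = b) (h4 : s.reg 4 = I.posB a b)
    (h5 : s.reg 5 = I.posA a b)
    (hp : (I.prefB b).idxOf a + s.arr 13 b + 1 = (I.prefB b).length)
    (hw : I.WantsB (I.edges.card + 1) (I.readEdges (s.arr 10)) (I.readEdges (s.arr 11)) b a) :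
    MainInv I ((Program.seq refuseMark refuseMove).run s) ∧
      mainPotential I ((Program.seq refuseMark refuseMove).run s) < mainPotential I s := by
  have hb : b ∈ I.prefA a := (I.mem_prefA_iff a b).2 ha
  have hx := I.readEdges_apply (s.arr 10) hb
  have hz := I.readEdges_apply (s.arr 11) hb
  have hzlt := h.run.level.z_lt_of_wantsB ha hp hw
  have hsum := sum_sub_bump (QuotaInstance.mem_edges.2 hb) hzlt
  have hbump := I.readEdges_update (s.arr 11) hb
  have h7 := frame_posB h.frame ha
  have hs6 := frame_startB h.frame b
  -- The pointer of `b` moves from worst to best, so it wraps around at the start of the list.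
  have htest : s.arr 6 b = I.posB a b ↔ (I.prefB b).idxOf a = 0 := by
    rw [hs6, QuotaInstance.posB]; omega
  have hptr : (fun j : Fin nB => ((Program.seq refuseMark refuseMove).run s).arr 13 j) =
      Function.update (fun j : Fin nB => s.arr 13 j) b
        (if (I.prefB b).idxOf a = 0 then 0 else s.arr 13 b + 1) := by
    rw [← update_val]
    by_cases hxz : s.arr 10 (I.posA a b) = s.arr 11 (I.posA a b) + 1 <;>
    by_cases ht : s.arr 6 b = I.posB a b <;>
    simp [Program.run, refuseMark, refuseMove, State.setReg, State.setArr, Expr.eval,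
      Test.eval_eq, hxz, ht, h3, h4, h5, h7, ← htest]
  have hframe : ∀ k < 8, ((Program.seq refuseMark refuseMove).run s).arr k = I.encode.arr k := by
    intro k hk
    rw [← h.frame k hk]
    by_cases hxz : s.arr 10 (I.posA a b) = s.arr 11 (I.posA a b) + 1 <;>
    by_cases ht : s.arr 6 b = I.posB a b <;>
    simp (discharger := omega) [Program.run, refuseMark, refuseMove, State.setReg, State.setArr,
      Expr.eval,
      Test.eval_eq, hxz, ht, h3, h4, h5, h7, Function.update_of_ne]
  have hrest : ((Program.seq refuseMark refuseMove).run s).reg 2 = s.reg 2 ∧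
      ((Program.seq refuseMark refuseMove).run s).reg 3 = s.reg 3 ∧
      ((Program.seq refuseMark refuseMove).run s).arr 9 = s.arr 9 ∧
      ((Program.seq refuseMark refuseMove).run s).arr 10 = s.arr 10 ∧
      ((Program.seq refuseMark refuseMove).run s).arr 12 = s.arr 12 ∧
      I.readEdges (((Program.seq refuseMark refuseMove).run s).arr 11) =
        bump (I.readEdges (s.arr 11)) a b := by
    rw [← hbump]
    by_cases hxz : s.arr 10 (I.posA a b) = s.arr 11 (I.posA a b) + 1 <;>
    by_cases ht : s.arr 6 b = I.posB a b <;>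
    simp [Program.run, refuseMark, refuseMove, State.setReg, State.setArr, Expr.eval,
      Test.eval_eq, hxz, ht, h3, h4, h5, h7]
  obtain ⟨e2, e3, e9, e10, e12, e11⟩ := hrest
  by_cases hxz : s.arr 10 (I.posA a b) = s.arr 11 (I.posA a b) + 1
  · have hchange : ((Program.seq refuseMark refuseMove).run s).reg 6 = s.reg 6 + 1 ∧
        ((Program.seq refuseMark refuseMove).run s).arr 8 =
          Function.update (s.arr 8) (I.posA a b) 0 ∧
        ((Program.seq refuseMark refuseMove).run s).arr 14 =
          Function.update (s.arr 14) a (s.arr 14 a - 1) ∧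
        ((Program.seq refuseMark refuseMove).run s).arr 15 =
          Function.update (s.arr 15) b (s.arr 15 b - 1) ∧
        ((Program.seq refuseMark refuseMove).run s).arr 16 =
          Function.update (s.arr 16) (s.reg 6) a := by
      by_cases ht : s.arr 6 b = I.posB a b <;>
      simp [Program.run, refuseMark, refuseMove, State.setReg, State.setArr, Expr.eval,
      Test.eval_eq, hxz, ht, h3, h4, h5, h7]
    obtain ⟨e6, e8, e14, e15, e16⟩ := hchange
    refine ⟨⟨hframe, e2.trans h.size, by rw [e9]; exact h.cross, ?_⟩, ?_⟩
    · rw [e3, e6, e8, e10, e11, e12, hptr, e14, e15, e16]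
      exact h.run.refuse_first ha hp hw (by rw [hx, hz, hxz])
    · rw [mainPotential, mainPotential, e6, e10, e11]
      omega
  · have hchange : ((Program.seq refuseMark refuseMove).run s).reg 6 = s.reg 6 ∧
        ((Program.seq refuseMark refuseMove).run s).arr 8 = s.arr 8 ∧
        ((Program.seq refuseMark refuseMove).run s).arr 14 = s.arr 14 ∧
        ((Program.seq refuseMark refuseMove).run s).arr 15 = s.arr 15 ∧
        ((Program.seq refuseMark refuseMove).run s).arr 16 = s.arr 16 := by
      by_cases ht : s.arr 6 b = I.posB a b <;>
      simp [Program.run, refuseMark, refuseMove, State.setArr, Expr.eval,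
      Test.eval_eq, hxz, ht, h3, h4, h5]
    obtain ⟨e6, e8, e14, e15, e16⟩ := hchange
    refine ⟨⟨hframe, e2.trans h.size, by rw [e9]; exact h.cross, ?_⟩, ?_⟩
    · rw [e3, e6, e8, e10, e11, e12, hptr, e14, e15, e16]
      exact h.run.refuse_again hsp ha hp hw (by rwa [hx, hz])
    · rw [mainPotential, mainPotential, e6, e10, e11]
      omega

theorem MainInv.offer (h : MainInv I s) (hsp : 0 < s.reg 6) {a : Fin nA} {b : Fin nB}
    (hb : b ∈ I.prefA a) (h7 : s.reg 7 = a) (h5 : s.reg 5 = I.posA a b)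
    (htop : s.arr 16 (s.reg 6 - 1) = a) (hp : (I.prefA a).idxOf b = s.arr 12 a)
    (hw : I.WantsA (I.edges.card + 1) (I.readEdges (s.arr 10)) (I.readEdges (s.arr 11)) a b)
    (hB : ∀ b, ∀ a ∈ I.prefB b,
      ¬ I.WantsB (I.edges.card + 1) (I.readEdges (s.arr 10)) (I.readEdges (s.arr 11)) b a) :
    MainInv I ((Program.seq offerMark offerMove).run s) ∧
      mainPotential I ((Program.seq offerMark offerMove).run s) < mainPotential I s := by
  have hx := I.readEdges_apply (s.arr 10) hb
  have hz := I.readEdges_apply (s.arr 11) hb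
  have hsum := sum_sub_bump (QuotaInstance.mem_edges.2 hb) hw.x_lt
  have hbump := I.readEdges_update (s.arr 10) hb
  have hbb := frame_posA h.frame hb
  -- The list of `a` ends where the next one starts; for the last `a` the entry `nA` of the array is
  -- the total length.
  have htest : I.posA a b + 1 = s.arr 4 (a + 1) ↔ s.arr 12 a + 1 = (I.prefA a).length := by
    rw [frame_startA h.frame, QuotaInstance.posA, I.listsA_eq, startOf_succ, hp]; omega
  have hptr : (fun j : Fin nA => ((Program.seq offerMark offerMove).run s).arr 12 j) =
      Function.update (fun j : Fin nA => s.arr 12 j) a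
        (if s.arr 12 a + 1 = (I.prefA a).length then 0 else s.arr 12 a + 1) := by
    rw [← update_val]
    by_cases hxz : s.arr 10 (I.posA a b) = s.arr 11 (I.posA a b) <;>
    by_cases ht : I.posA a b + 1 = s.arr 4 (a + 1) <;>
    simp [Program.run, offerMark, offerMove, State.setReg, State.setArr, Expr.eval,
      Test.eval_eq, hxz, ht, h5, h7, hbb, ← htest]
  have hframe : ∀ k < 8, ((Program.seq offerMark offerMove).run s).arr k = I.encode.arr k := by
    intro k hk
    rw [← h.frame k hk]
    by_cases hxz : s.arr 10 (I.posA a b) = s.arr 11 (I.posA a b) <;>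
    by_cases ht : I.posA a b + 1 = s.arr 4 (a + 1) <;>
    simp (discharger := omega) [Program.run, offerMark, offerMove, State.setReg, State.setArr,
      Expr.eval,
      Test.eval_eq, hxz, ht, h5, h7, hbb, Function.update_of_ne]
  have hrest : ((Program.seq offerMark offerMove).run s).reg 2 = s.reg 2 ∧
      ((Program.seq offerMark offerMove).run s).reg 6 = s.reg 6 ∧
      ((Program.seq offerMark offerMove).run s).arr 9 = s.arr 9 ∧
      ((Program.seq offerMark offerMove).run s).arr 11 = s.arr 11 ∧
      ((Program.seq offerMark offerMove).run s).arr 13 = s.arr 13 ∧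
      ((Program.seq offerMark offerMove).run s).arr 16 = s.arr 16 ∧
      I.readEdges (((Program.seq offerMark offerMove).run s).arr 10) =
        bump (I.readEdges (s.arr 10)) a b := by
    rw [← hbump]
    by_cases hxz : s.arr 10 (I.posA a b) = s.arr 11 (I.posA a b) <;>
    by_cases ht : I.posA a b + 1 = s.arr 4 (a + 1) <;>
    simp [Program.run, offerMark, offerMove, State.setReg, State.setArr, Expr.eval,
      Test.eval_eq, hxz, ht, h5, h7, hbb]
  obtain ⟨e2, e6, e9, e11, e13, e16, e10⟩ := hrest
  by_cases hxz : s.arr 10 (I.posA a b) = s.arr 11 (I.posA a b)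
  · have hchange : ((Program.seq offerMark offerMove).run s).reg 3 = b ∧
        ((Program.seq offerMark offerMove).run s).arr 8 =
          Function.update (s.arr 8) (I.posA a b) 1 ∧
        ((Program.seq offerMark offerMove).run s).arr 14 =
          Function.update (s.arr 14) a (s.arr 14 a + 1) ∧
        ((Program.seq offerMark offerMove).run s).arr 15 =
          Function.update (s.arr 15) b (s.arr 15 b + 1) := by
      by_cases ht : I.posA a b + 1 = s.arr 4 (a + 1) <;>
      simp [Program.run, offerMark, offerMove, State.setReg, State.setArr, Expr.eval,
      Test.eval_eq, hxz, ht, h5, h7, hbb]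
    obtain ⟨e3, e8, e14, e15⟩ := hchange
    refine ⟨⟨hframe, e2.trans h.size, by rw [e9]; exact h.cross, ?_⟩, ?_⟩
    · rw [e3, e6, e8, e10, e11, e13, hptr, e14, e15, e16]
      exact h.run.offer_first hsp hb hp htop hw hB (by rw [hx, hz, hxz])
    · rw [mainPotential, mainPotential, e6, e10, e11]
      omega
  · have hchange : ((Program.seq offerMark offerMove).run s).reg 3 = s.reg 3 ∧
        ((Program.seq offerMark offerMove).run s).arr 8 = s.arr 8 ∧
        ((Program.seq offerMark offerMove).run s).arr 14 = s.arr 14 ∧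
        ((Program.seq offerMark offerMove).run s).arr 15 = s.arr 15 := by
      by_cases ht : I.posA a b + 1 = s.arr 4 (a + 1) <;>
      simp [Program.run, offerMark, offerMove, State.setArr, Expr.eval,
      Test.eval_eq, hxz, ht, h5, h7]
    obtain ⟨e3, e8, e14, e15⟩ := hchange
    refine ⟨⟨hframe, e2.trans h.size, by rw [e9]; exact h.cross, ?_⟩, ?_⟩
    · rw [e3, e6, e8, e10, e11, e13, hptr, e14, e15, e16]
      exact h.run.offer_again hsp hb hp htop hw (by rwa [hx, hz])
    · rw [mainPotential, mainPotential, e6, e10, e11]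
      omega

theorem MainInv.pop (h : MainInv I s) (hsp : 0 < s.reg 6) {a : Fin nA}
    (htop : s.arr 16 (s.reg 6 - 1) = a)
    (hw : ∀ b ∈ I.prefA a,
      ¬ I.WantsA (I.edges.card + 1) (I.readEdges (s.arr 10)) (I.readEdges (s.arr 11)) a b)
    (hB : ∀ b, ∀ a ∈ I.prefB b,
      ¬ I.WantsB (I.edges.card + 1) (I.readEdges (s.arr 10)) (I.readEdges (s.arr 11)) b a) :
    MainInv I (s.setReg 6 (s.reg 6 - 1)) ∧
      mainPotential I (s.setReg 6 (s.reg 6 - 1)) < mainPotential I s := by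
  refine ⟨⟨h.frame, by simpa [State.setReg] using h.size, h.cross, ?_⟩, ?_⟩
  · simpa [State.setReg] using h.run.pop htop hw hB
  · simp only [mainPotential, State.setReg, Function.update_self]
    omega

theorem MainInv.testB_iff (h : MainInv I s) {a : Fin nA} {b : Fin nB} (ha : a ∈ I.prefB b)
    (h3 : s.reg 3 = b) (h5 : s.reg 5 = I.posA a b) :
    testB.eval s = true ↔
      I.WantsB (I.edges.card + 1) (I.readEdges (s.arr 10)) (I.readEdges (s.arr 11)) b a := by
  have hb : b ∈ I.prefA a := (I.mem_prefA_iff a b).2 ha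
  have hz := I.readEdges_apply (s.arr 11) hb
  have hc := h.run.cntB_eq b
  rw [QuotaInstance.WantsB, ← hc, hz]
  simp only [testB, Test.eval_lt, Test.eval_not, Test.eval_and, Expr.eval, h3, h5, h.size, frame_lowB h.frame, frame_upB h.frame]
  tauto

theorem MainInv.testA_iff (h : MainInv I s) {a : Fin nA} {b : Fin nB} (hb : b ∈ I.prefA a)
    (h7 : s.reg 7 = a) (h5 : s.reg 5 = I.posA a b) :
    testA.eval s = true ↔
      I.WantsA (I.edges.card + 1) (I.readEdges (s.arr 10)) (I.readEdges (s.arr 11)) a b := by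
  have hx := I.readEdges_apply (s.arr 10) hb
  have hc := h.run.cntA_eq a
  -- With `s = |E| + 1`, these are the thresholds `s + 2` and `2s + 2` as the program computes them
  -- from register 2.
  have e1 : I.edges.card + 1 + 2 = I.edges.card + 3 := by ring
  have e2 : 2 * (I.edges.card + 1) + 2 = I.edges.card + I.edges.card + 4 := by ring
  rw [QuotaInstance.WantsA, ← hc, hx, e1, e2]
  simp only [testA, Test.eval_lt, Test.eval_not, Test.eval_and, Expr.eval, h7, h5, h.size, frame_lowA h.frame, frame_upA h.frame]
  tauto

/-- At a vertex without neighbours the test fails, whatever is in register 5. -/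
theorem MainInv.testB_of_isolated (h : MainInv I s) {b : Fin nB} (hb : I.prefB b = [])
    (h3 : s.reg 3 = b) : testB.eval s = false := by
  have hc : s.arr 15 b = 0 := by
    rw [h.run.cntB_eq b, Finset.card_eq_zero, Finset.eq_empty_iff_forall_notMem]
    intro a ha
    rw [mem_partnersB, QuotaInstance.mem_held, I.mem_prefA_iff, hb] at ha
    simp at ha
  rw [← Bool.not_eq_true]
  simp [testB, Test.eval_lt, Test.eval_not, Test.eval_and, Expr.eval, h3, hc]

/-- A round performs a refusal by the current `b`, or else an offer by the top of the stack, or else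
a pop. -/
theorem MainInv.step (h : MainInv I s) (ht : mainTest.eval s = true) :
    MainInv I (mainBody.run s) ∧ mainPotential I (mainBody.run s) < mainPotential I s := by
  have hsp : 0 < s.reg 6 := by
    simpa [mainTest, Test.eval_lt, Expr.eval, ← Bool.not_eq_true] using ht
  obtain ⟨a₀, ha₀, htop⟩ := h.run.stack_valid (s.reg 6 - 1) (by omega)
  obtain ⟨b₀, hb₀⟩ := List.exists_mem_of_ne_nil _ ha₀
  -- The vertex on the stack has a neighbour, so `B` is nonempty and register 3 names a genuine
  -- vertex.
  obtain ⟨b, h3⟩ : ∃ b : Fin nB, s.reg 3 = b := ⟨⟨_, h.run.cur_lt b₀.pos⟩, rfl⟩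
  set f := s.arr 6 (s.reg 3 + 1) - (s.arr 13 (s.reg 3) + 1) with hf
  set s₁ := (s.setReg 4 f).setReg 5 (s.arr 9 f) with hs₁
  have hrun : mainBody.run s = (Program.branch testB (.seq refuseMark refuseMove)
    (.seq (.assign 7 (.get 16 (.sub (.reg 6) (.const 1))))
    (.seq (.assign 5 (.add (.get 4 (.reg 7)) (.get 12 (.reg 7))))
    (.branch testA (.seq offerMark offerMove)
      (.assign 6 (.sub (.reg 6) (.const 1))))))).run s₁ := by
    simp only [mainBody, Program.run, Expr.eval, hs₁, State.setReg, Function.update_self, hf]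
  have h₁ : MainInv I s₁ := (h.setReg (by norm_num) (by norm_num) (by norm_num)).setReg
    (by norm_num) (by norm_num) (by norm_num)
  have hΦ₁ : mainPotential I s₁ = mainPotential I s := by
    rw [hs₁, mainPotential_setReg (by norm_num), mainPotential_setReg (by norm_num)]
  have h3₁ : s₁.reg 3 = b := h3
  have h6₁ : s₁.reg 6 = s.reg 6 := rfl
  have harr₁ : s₁.arr = s.arr := rfl
  -- For an isolated `b` the address in register 4 has no meaning, but then `testB` fails anyway.
  have hpointer : I.prefB b ≠ [] → ∃ a ∈ I.prefB b, s₁.reg 4 = I.posB a b ∧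
      s₁.reg 5 = I.posA a b ∧ (I.prefB b).idxOf a + s₁.arr 13 b + 1 = (I.prefB b).length := by
    intro hne
    have hlt := h.run.level.pB_lt b hne
    have hk : (I.prefB b).length - 1 - s.arr 13 b < (I.prefB b).length := by omega
    have hidx := (I.prefB_nodup b).idxOf_getElem _ hk
    have hmem := List.getElem_mem hk
    refine ⟨_, hmem, ?_⟩
    have hfpos : f = I.posB (I.prefB b)[(I.prefB b).length - 1 - s.arr 13 b] b := by
      rw [hf, h3, frame_startB h.frame, I.listsB_eq, startOf_succ, QuotaInstance.posB, hidx,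
        I.listsB_eq]
      omega
    refine ⟨hfpos, ?_, ?_⟩
    · rw [← h.cross _ b ((I.mem_prefA_iff _ b).2 hmem), ← hfpos]
      rfl
    · rw [hidx, harr₁]; omega
  rw [hrun, ← hΦ₁]
  by_cases htB : testB.eval s₁ = true
  · have hne : I.prefB b ≠ [] := fun hnil => by
      simp [h₁.testB_of_isolated hnil h3₁] at htB
    obtain ⟨a, ha, h4₁, h5₁, hp⟩ := hpointer hne
    rw [Program.run, if_pos htB]
    exact h₁.refuse (h6₁ ▸ hsp) ha h3₁ h4₁ h5₁ hp ((h₁.testB_iff ha h3₁ h5₁).1 htB)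
  -- Only the current `b` could want to refuse, and its pointer entry speaks for its whole list.
  · have hB : ∀ b, ∀ a ∈ I.prefB b, ¬ I.WantsB (I.edges.card + 1) (I.readEdges (s.arr 10))
        (I.readEdges (s.arr 11)) b a := by
      intro b' a' ha' hw'
      have hbb : b = b' := Fin.ext (h3.symm.trans (h.run.wantsB_cur b' a' ha' hw'))
      subst hbb
      obtain ⟨a, ha, h4₁, h5₁, hp⟩ := hpointer (List.ne_nil_of_mem ha')
      exact htB ((h₁.testB_iff ha h3₁ h5₁).2 (h.run.level.wantsB_pointer ha hp ha' hw'))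
    set s₂ := (s₁.setReg 7 a₀).setReg 5 (s.arr 4 a₀ + s.arr 12 a₀) with hs₂
    have hrun₂ : (Program.seq (.assign 7 (.get 16 (.sub (.reg 6) (.const 1))))
      (.seq (.assign 5 (.add (.get 4 (.reg 7)) (.get 12 (.reg 7))))
      (.branch testA (.seq offerMark offerMove)
        (.assign 6 (.sub (.reg 6) (.const 1)))))).run s₁ =
        (Program.branch testA (.seq offerMark offerMove)
          (.assign 6 (.sub (.reg 6) (.const 1)))).run s₂ := by
      simp only [Program.run, Expr.eval, hs₂, State.setReg, Function.update_self, h6₁, harr₁, htop]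
    have h₂ : MainInv I s₂ := (h₁.setReg (by norm_num) (by norm_num) (by norm_num)).setReg
      (by norm_num) (by norm_num) (by norm_num)
    have hΦ₂ : mainPotential I s₂ = mainPotential I s₁ := by
      rw [hs₂, mainPotential_setReg (by norm_num), mainPotential_setReg (by norm_num)]
    have h7₂ : s₂.reg 7 = a₀ := rfl
    have h6₂ : s₂.reg 6 = s.reg 6 := rfl
    have harr₂ : s₂.arr = s.arr := rfl
    have hlt := h.run.level.pA_lt a₀ ha₀
    have hidx := (I.prefA_nodup a₀).idxOf_getElem _ hlt
    have hmem := List.getElem_mem hlt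
    have h5₂ : s₂.reg 5 = I.posA a₀ (I.prefA a₀)[s.arr 12 a₀] := by
      rw [QuotaInstance.posA, hidx, ← frame_startA h.frame]; rfl
    rw [Program.run, if_neg htB, hrun₂, ← hΦ₂]
    by_cases htA : testA.eval s₂ = true
    · rw [Program.run, if_pos htA]
      exact h₂.offer (h6₂ ▸ hsp) hmem h7₂ h5₂ (by rw [harr₂, h6₂, htop]) hidx
        ((h₂.testA_iff hmem h7₂ h5₂).1 htA) hB
    · rw [Program.run, if_neg htA]
      refine h₂.pop (h6₂ ▸ hsp) (a := a₀) (by rw [harr₂, h6₂, htop]) (fun b' hb' hw' => ?_) hB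
      exact htA ((h₂.testA_iff hmem h7₂ h5₂).2 (h.run.level.wantsA_pointer hmem hidx hb' hw'))

theorem MainInv.levelCertificate (h : MainInv I s) (ht : mainTest.eval s = false) :
    LevelCertificate I (I.output s) (I.edges.card + 1) (I.readEdges (s.arr 10))
      (I.readEdges (s.arr 11)) := by
  have hsp : s.reg 6 = 0 := by
    simpa [mainTest, Test.eval_lt, Expr.eval, ← Bool.not_eq_true] using ht
  have hout : I.output s = I.held (I.readEdges (s.arr 10)) (I.readEdges (s.arr 11)) := by
    ext ⟨a, b⟩
    rw [QuotaInstance.output, Finset.mem_filter, QuotaInstance.mem_edges]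
    refine ⟨fun hab => (h.run.out_eq a b hab.1).1 hab.2, fun hab => ?_⟩
    have hb := (QuotaInstance.mem_held.1 hab).1
    exact ⟨hb, (h.run.out_eq a b hb).2 hab⟩
  rw [hout]
  refine h.run.level.levelCertificate (fun a b hb hw => ?_) (h.run.empty hsp)
  obtain ⟨i, hi, -⟩ := h.run.wantsA_mem a b hb hw
  omega

end ManyToMany

namespace ManyToMany

open Finset

/-! ### The preparation

The loop runs through the positions of the lists of `B`, with the current vertex of `B` in
register 3 and the current position in register 4, and searches for the edge in the list of its
other end with register 5. -/

/-- The entry of array 4 after the last vertex is the number of edges. Without edges, the value put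
in register 5 comes from default zeros and is never used. -/
def prepareInit : Program :=
  .seq (.assign 2 (.get 4 (.reg 0))) (.assign 5 (.get 4 (.get 7 (.const 0))))

def prepareTest : Test := .lt (.reg 4) (.reg 2)

def prepareBody : Program :=
  .branch (.eq (.reg 4) (.get 6 (.add (.reg 3) (.const 1))))
    (.assign 3 (.add (.reg 3) (.const 1)))
    (.branch (.eq (.get 5 (.reg 5)) (.reg 3))
      (.seq (.store 9 (.reg 4) (.reg 5))
      (.seq (.store 16 (.reg 4) (.get 7 (.reg 4)))
      (.seq (.assign 4 (.add (.reg 4) (.const 1)))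
        (.assign 5 (.get 4 (.get 7 (.reg 4)))))))
      (.assign 5 (.add (.reg 5) (.const 1))))

/-- The stack starts with one entry per edge, its end in `A`. Repetitions do no harm, and isolated
vertices never appear. -/
def prepareEnd : Program :=
  .seq (.assign 6 (.reg 4)) (.assign 3 (.const 0))

def mainProgram : Program :=
  .seq prepareInit (.seq (.loop prepareTest prepareBody) (.seq prepareEnd
    (.loop mainTest mainBody)))

variable {nA nB : ℕ}

structure PrepareInv (I : QuotaInstance (Fin nA) (Fin nB)) (s : State) : Prop where
  frame : ∀ k < 8, s.arr k = I.encode.arr k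
  zero : ∀ k, 8 ≤ k → k ≠ 9 → k ≠ 16 → s.arr k = fun _ => 0
  size : s.reg 2 = I.edges.card
  position_le : s.reg 4 ≤ I.edges.card
  vertex_le : s.reg 3 ≤ nB
  start_le : startOf I.listsB (s.reg 3) ≤ s.reg 4
  le_next : s.reg 4 ≤ startOf I.listsB (s.reg 3 + 1)
  cursor : ∀ b, ∀ a ∈ I.prefB b, I.posB a b = s.reg 4 →
    startOf I.listsA a ≤ s.reg 5 ∧ s.reg 5 ≤ I.posA a b
  done : ∀ b, ∀ a ∈ I.prefB b, I.posB a b < s.reg 4 →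
    s.arr 9 (I.posB a b) = I.posA a b ∧ s.arr 16 (I.posB a b) = a
  stack_valid : ∀ i < s.reg 4, ∃ a : Fin nA, I.prefA a ≠ [] ∧ s.arr 16 i = a

/-- Going on to the next edge resets the search cursor, which raises the last term by at most `|E|`;
the weight `|E| + 2` outweighs this. -/
def preparePotential (I : QuotaInstance (Fin nA) (Fin nB)) (s : State) : ℕ :=
  (nB - s.reg 3) + (I.edges.card - s.reg 4) * (I.edges.card + 2) + (I.edges.card - s.reg 5)

variable {I : QuotaInstance (Fin nA) (Fin nB)} {s : State}

theorem QuotaInstance.posB_lt {a : Fin nA} {b : Fin nB} (h : a ∈ I.prefB b) :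
    I.posB a b < I.edges.card := by
  rw [← startOf_listsB_last]
  exact startOf_add_lt I.prefB b (List.idxOf_lt_length_iff.2 h)

theorem PrepareInv.step (h : PrepareInv I s) (ht : prepareTest.eval s = true) :
    PrepareInv I (prepareBody.run s) ∧
      preparePotential I (prepareBody.run s) < preparePotential I s := by
  have hlt : s.reg 4 < I.edges.card := by
    simpa [prepareTest, Test.eval_lt, Expr.eval, h.size] using ht
  -- Past the last vertex the start of the list would be `|E|`, beyond the current position.
  have hb : s.reg 3 < nB := by
    refine lt_of_le_of_ne h.vertex_le fun e => ?_
    have := h.start_le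
    rw [e, I.startOf_listsB_last] at this
    omega
  by_cases hnext : s.reg 4 = startOf I.listsB (s.reg 3 + 1)
  · have hrun : prepareBody.run s = s.setReg 3 (s.reg 3 + 1) := by
      simp [prepareBody, Program.run, Test.eval_eq, Expr.eval, frame_startB h.frame, ← hnext]
    rw [hrun]
    refine ⟨⟨h.frame, h.zero, ?_, ?_, ?_, ?_, ?_, ?_, ?_, ?_⟩, ?_⟩
    · simpa [State.setReg] using h.size
    · simpa [State.setReg] using h.position_le
    · simpa [State.setReg] using hb
    · simp [State.setReg, hnext]
    · simpa [State.setReg, hnext] using startOf_mono I.listsB (Nat.le_succ _)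
    · simpa [State.setReg] using h.cursor
    · simpa [State.setReg] using h.done
    · simpa [State.setReg] using h.stack_valid
    · simp [preparePotential, State.setReg]
      omega
  obtain ⟨b, hbv⟩ : ∃ b : Fin nB, s.reg 3 = b := ⟨⟨_, hb⟩, rfl⟩
  have hstart := h.start_le
  have hle := h.le_next
  have hsucc := startOf_succ I.prefB b
  rw [hbv, I.listsB_eq] at hstart
  rw [hbv, I.listsB_eq] at hle hnext
  have hk : s.reg 4 - startOf (valLists I.prefB) b < (I.prefB b).length := by omega
  obtain ⟨a, ha⟩ : ∃ a, (I.prefB b)[s.reg 4 - startOf (valLists I.prefB) b] = a := ⟨_, rfl⟩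
  have hidx := (I.prefB_nodup b).idxOf_getElem _ hk
  have hmem := List.getElem_mem hk
  rw [ha] at hidx hmem
  have hpos : I.posB a b = s.reg 4 := by
    rw [QuotaInstance.posB, hidx, I.listsB_eq]; omega
  have hab : b ∈ I.prefA a := (I.mem_prefA_iff a b).2 hmem
  obtain ⟨hc1, hc2⟩ := h.cursor b a hmem hpos
  have hposA := QuotaInstance.posA_lt hab
  -- The cursor lies within the list of `a`, where `b` occurs only once; other lists may contain `b`
  -- as well.
  have hsearch : s.arr 5 (s.reg 5) = b ↔ s.reg 5 = I.posA a b := by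
    refine ⟨fun he => ?_, fun he => he ▸ frame_posA h.frame hab⟩
    have hk' : s.reg 5 - startOf I.listsA a < (I.prefA a).length := by
      have := List.idxOf_lt_length_iff.2 hab
      rw [QuotaInstance.posA] at hc2
      omega
    have hget := arrayOf_flatten I.prefA a hk'
    rw [← I.listsA_eq, Nat.add_sub_cancel' hc1] at hget
    rw [h.frame 5 (by norm_num)] at he
    have hget' := hget.symm.trans he
    have hidx' := (I.prefA_nodup a).idxOf_getElem _ hk'
    rw [Fin.ext hget'] at hidx'
    rw [QuotaInstance.posA, hidx']
    omega
  have hnext' : ¬ s.reg 4 = s.arr 6 (b + 1) := by rwa [frame_startB h.frame]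
  by_cases hfound : s.reg 5 = I.posA a b
  · have hrun : prepareBody.run s =
        ⟨Function.update (Function.update s.reg 4 (s.reg 4 + 1)) 5
          (s.arr 4 (s.arr 7 (s.reg 4 + 1))),
        Function.update (Function.update s.arr 9 (Function.update (s.arr 9) (s.reg 4) (s.reg 5))) 16
          (Function.update (s.arr 16) (s.reg 4) (s.arr 7 (s.reg 4)))⟩ := by
      simp [prepareBody, Program.run, Test.eval_eq, Expr.eval, hbv, hnext', hsearch.2 hfound,
        State.setReg, State.setArr]
    have h7 : s.arr 7 (s.reg 4) = a := by rw [← hpos]; exact frame_posB h.frame hmem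
    rw [hrun]
    refine ⟨⟨fun k hk => ?_, fun k h8 h9 h16 => ?_, ?_, ?_, ?_, ?_, ?_, ?_, ?_, ?_⟩, ?_⟩
    · simpa (discharger := omega) [Function.update_of_ne] using h.frame k hk
    · simpa [Function.update_of_ne h9, Function.update_of_ne h16] using h.zero k h8 h9 h16
    · simpa using h.size
    · simpa using hlt
    · simpa using h.vertex_le
    · simp [hbv, I.listsB_eq]; omega
    · simp [hbv, I.listsB_eq]; omega
    -- The new cursor is the start of the list of the next edge's end in `A`. After the last edge
    -- there is no such edge and nothing to prove.
    · intro b' a' ha' hp'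
      simp only [ne_eq, Nat.reduceEqDiff, not_false_eq_true,
        Function.update_of_ne, Function.update_self] at hp' ⊢
      rw [← hp', frame_posB h.frame ha', frame_startA h.frame]
      exact ⟨le_rfl, Nat.le_add_right _ _⟩
    · intro b' a' ha' hp'
      simp only [ne_eq, Nat.reduceEqDiff, not_false_eq_true,
        Function.update_of_ne, Function.update_self] at hp' ⊢
      rcases Nat.lt_succ_iff_lt_or_eq.1 hp' with hp' | hp'
      · rw [Function.update_of_ne hp'.ne, Function.update_of_ne hp'.ne]
        exact h.done b' a' ha' hp'
      · rw [hp', Function.update_self, Function.update_self, hfound, h7]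
        obtain ⟨rfl, rfl⟩ := (QuotaInstance.posB_inj hmem ha').1 (hpos.trans hp'.symm)
        exact ⟨rfl, rfl⟩
    · intro i hi
      simp only [ne_eq, Nat.reduceEqDiff, not_false_eq_true,
        Function.update_of_ne, Function.update_self] at hi ⊢
      rcases Nat.lt_succ_iff_lt_or_eq.1 hi with hi | hi
      · rw [Function.update_of_ne hi.ne]
        exact h.stack_valid i hi
      · exact ⟨a, List.ne_nil_of_mem hab, by rw [hi, Function.update_self, h7]⟩
    · simp only [preparePotential, ne_eq, Nat.reduceEqDiff,
        not_false_eq_true, Function.update_of_ne, Function.update_self]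
      have h1 : I.edges.card - s.reg 4 = (I.edges.card - (s.reg 4 + 1)) + 1 := by omega
      rw [h1, Nat.add_mul _ 1]
      omega
  · have hrun : prepareBody.run s = s.setReg 5 (s.reg 5 + 1) := by
      simp [prepareBody, Program.run, Test.eval_eq, Expr.eval, hbv, hnext', hsearch, hfound]
    rw [hrun]
    refine ⟨⟨h.frame, h.zero, ?_, ?_, ?_, ?_, ?_, ?_, ?_, ?_⟩, ?_⟩
    · simpa [State.setReg] using h.size
    · simpa [State.setReg] using h.position_le
    · simpa [State.setReg] using h.vertex_le
    · simpa [State.setReg] using h.start_le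
    · simpa [State.setReg] using h.le_next
    · intro b' a' ha' hp'
      replace hp' : I.posB a' b' = s.reg 4 := hp'
      obtain ⟨rfl, rfl⟩ := (QuotaInstance.posB_inj hmem ha').1 (hpos.trans hp'.symm)
      simp only [State.setReg, Function.update_self]
      omega
    · simpa [State.setReg] using h.done
    · simpa [State.setReg] using h.stack_valid
    · simp [preparePotential, State.setReg]
      omega

variable (I) in
theorem PrepareInv.init : PrepareInv I (prepareInit.run I.encode) ∧
    preparePotential I (prepareInit.run I.encode) ≤
      nB + I.edges.card * (I.edges.card + 2) + I.edges.card := by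
  have h3 : (prepareInit.run I.encode).reg 3 = 0 := rfl
  have h4 : (prepareInit.run I.encode).reg 4 = 0 := rfl
  refine ⟨⟨fun _ _ => rfl, fun k h8 h9 h16 => ?_, ?_, ?_, ?_, ?_, ?_, fun b a ha hp => ?_,
    fun b a ha hp => ?_, fun i hi => ?_⟩, ?_⟩
  · change I.encode.arr k = _
    obtain ⟨j, rfl⟩ := Nat.exists_eq_add_of_le' h8
    rfl
  · exact I.startOf_listsA_last
  · rw [h4]; exact Nat.zero_le _
  · rw [h3]; exact Nat.zero_le _
  · rw [h3, startOf_zero]; exact Nat.zero_le _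
  · rw [h4]; exact Nat.zero_le _
  · have h5 : (prepareInit.run I.encode).reg 5 = startOf I.listsA (I.encode.arr 7 0) := rfl
    rw [h4] at hp
    rw [h5, ← hp, frame_posB (fun _ _ => rfl) ha]
    exact ⟨le_rfl, Nat.le_add_right _ _⟩
  · omega
  · omega
  · simp only [preparePotential, h3, h4, Nat.sub_zero]
    omega

theorem PrepareInv.mainInv (h : PrepareInv I s) (ht : prepareTest.eval s = false) :
    MainInv I (prepareEnd.run s) ∧ mainPotential I (prepareEnd.run s) =
      3 * (I.edges.card * (2 * I.edges.card + 4)) + I.edges.card := by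
  have h4 : s.reg 4 = I.edges.card := by
    refine le_antisymm h.position_le ?_
    simpa [prepareTest, Test.eval_lt, Expr.eval, h.size, ← Bool.not_eq_true] using ht
  have e2 : (prepareEnd.run s).reg 2 = s.reg 2 := rfl
  have e3 : (prepareEnd.run s).reg 3 = 0 := rfl
  have e6 : (prepareEnd.run s).reg 6 = I.edges.card := h4
  have earr : (prepareEnd.run s).arr = s.arr := rfl
  have hread : I.readEdges (fun _ => 0) = fun _ _ => 0 := by
    ext a b; simp [QuotaInstance.readEdges]
  have z8 := h.zero 8 (by norm_num) (by norm_num) (by norm_num)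
  have z10 := h.zero 10 (by norm_num) (by norm_num) (by norm_num)
  have z11 := h.zero 11 (by norm_num) (by norm_num) (by norm_num)
  have z12 := h.zero 12 (by norm_num) (by norm_num) (by norm_num)
  have z13 := h.zero 13 (by norm_num) (by norm_num) (by norm_num)
  have z14 := h.zero 14 (by norm_num) (by norm_num) (by norm_num)
  have z15 := h.zero 15 (by norm_num) (by norm_num) (by norm_num)
  refine ⟨⟨h.frame, h.size, fun a b hb => ?_, ?_⟩, ?_⟩
  · have ha := (I.mem_prefA_iff a b).1 hb
    exact (h.done b a ha (h4 ▸ QuotaInstance.posB_lt ha)).1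
  · rw [e3, e6, earr, z8, z10, z11, z12, z13, z14, z15, hread]
    refine QuotaInstance.RunInv.init (h4 ▸ h.stack_valid) fun a hne => ?_
    obtain ⟨b, hb⟩ := List.exists_mem_of_ne_nil _ hne
    have ha := (I.mem_prefA_iff a b).1 hb
    have hlt := QuotaInstance.posB_lt ha
    exact ⟨I.posB a b, hlt, (h.done b a ha (h4 ▸ hlt)).2⟩
  · rw [mainPotential, e6, earr, z10, z11, hread]
    simp only [Nat.sub_zero, Finset.sum_const, smul_eq_mul]
    ring

def mainProgramBound : ℕ :=
  prepareInit.stepBound + 6 * (prepareBody.stepBound + prepareTest.cost + 1) +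
    prepareEnd.stepBound + 20 * (mainBody.stepBound + mainTest.cost + 1)

theorem exists_exec_mainProgram (I : QuotaInstance (Fin nA) (Fin nB)) :
    ∃ s T x z, Exec mainProgram I.encode s T ∧
      T ≤ mainProgramBound * (max 1 I.edges.card * max 1 (nA + nB + I.edges.card)) ∧
      LevelCertificate I (I.output s) (I.edges.card + 1) x z := by
  obtain ⟨n₁, hn₁, h₁⟩ := (show prepareInit.LoopFree from ⟨trivial, trivial⟩).exec_run I.encode
  obtain ⟨hi₁, hΦ₁⟩ := PrepareInv.init I
  obtain ⟨s₂, n₂, h₂, hi₂, ht₂, hn₂⟩ := exec_loop_of_potential (t := prepareTest)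
    (by simp [prepareBody, Program.LoopFree]) (PrepareInv I) (preparePotential I)
    (fun _ => PrepareInv.step) _ hi₁
  obtain ⟨n₃, hn₃, h₃⟩ := (show prepareEnd.LoopFree from ⟨trivial, trivial⟩).exec_run s₂
  obtain ⟨hi₃, hΦ₃⟩ := hi₂.mainInv ht₂
  obtain ⟨s₄, n₄, h₄, hi₄, ht₄, hn₄⟩ := exec_loop_of_potential (t := mainTest)
    mainBody_loopFree (MainInv I) (mainPotential I) (fun _ => MainInv.step) _ hi₃
  refine ⟨s₄, _, _, _, .seq h₁ (.seq h₂ (.seq h₃ h₄)), ?_, hi₄.levelCertificate ht₄⟩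
  set E := I.edges.card
  set m := max 1 E
  set v := max 1 (nA + nB + E)
  have hm1 : 1 ≤ m := le_max_left _ _
  have hmE : E ≤ m := le_max_right _ _
  have hv1 : 1 ≤ v := le_max_left _ _
  have hvE : nA + nB + E ≤ v := le_max_right _ _
  have hone : 1 ≤ m * v := Nat.mul_le_mul hm1 hv1
  have hE : E ≤ m * v := by simpa using Nat.mul_le_mul hmE hv1
  -- The products `1`, `E`, `E * E` and `nB` are each at most `m * v`, so the factors 6 and 20 below
  -- are sums of coefficients: `nB + E² + 3E + 1` and `6E² + 13E + 1`.
  have hEE : E * E ≤ m * v := Nat.mul_le_mul hmE (by omega)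
  have hnB : nB ≤ m * v := by
    simpa using Nat.mul_le_mul hm1 (show nB ≤ v by omega)
  have b₂ : preparePotential I (prepareInit.run I.encode) + 1 ≤ 6 * (m * v) := by
    have : E * (E + 2) = E * E + 2 * E := by ring
    omega
  have b₄ : mainPotential I (prepareEnd.run s₂) + 1 ≤ 20 * (m * v) := by
    have : E * (2 * E + 4) = 2 * (E * E) + 4 * E := by ring
    omega
  have c₁ : n₁ ≤ prepareInit.stepBound * (m * v) := hn₁.trans (Nat.le_mul_of_pos_right _ hone)
  have c₂ := hn₂.trans (Nat.mul_le_mul_right (prepareBody.stepBound + prepareTest.cost + 1) b₂)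
  have c₃ : n₃ ≤ prepareEnd.stepBound * (m * v) := hn₃.trans (Nat.le_mul_of_pos_right _ hone)
  have c₄ := hn₄.trans (Nat.mul_le_mul_right (mainBody.stepBound + mainTest.cost + 1) b₄)
  calc n₁ + (n₂ + (n₃ + n₄)) ≤ _ :=
        Nat.add_le_add c₁ (Nat.add_le_add c₂ (Nat.add_le_add c₃ c₄))
    _ = mainProgramBound * (m * v) := by rw [mainProgramBound]; ring

end ManyToMany

theorem theorem1 :
    ∃ (P : ManyToMany.Program) (C : ℕ),
      ∀ (nA nB : ℕ) (I : ManyToMany.QuotaInstance (Fin nA) (Fin nB)),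
        ∃ (s : ManyToMany.State) (T : ℕ),
          ManyToMany.Exec P I.encode s T ∧
          T ≤ C * (max 1 I.edges.card * max 1 (nA + nB + I.edges.card)) ∧
          I.IsCritical (I.output s) ∧
          I.IsPopularCritical (I.output s) ∧
          ∀ N : Finset (Fin nA × Fin nB),
            I.IsPopularCritical N → N.card ≤ (I.output s).card := by
  refine ⟨ManyToMany.mainProgram, ManyToMany.mainProgramBound, fun nA nB I => ?_⟩
  obtain ⟨s, T, x, z, hexec, hT, hcert⟩ := ManyToMany.exists_exec_mainProgram I
  exact ⟨s, T, hexec, hT, hcert.isCritical (Nat.lt_succ_self _),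
    hcert.isPopularCritical (Nat.lt_succ_self _), fun N hN => hcert.card_le (Nat.lt_succ_self _) hN⟩
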